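/- Let $\mathbb{D}$ be the open unit disk in $\mathbb{C}$ with normalized area measure $dA$, and let $n\ge 1$ be an integer. A function $h:\mathbb{D}\to\mathbb{C}$ is called $n$-analytic if it is $n$ times continuously differentiable (in the real sense) and $\partial^n h/\partial\bar z^{\,n}=0$ on $\mathbb{D}$. Let $A^2_n$ be the space of all $n$-analytic functions in $L^2(\mathbb{D},dA)$, with the norm and inner product of $L^2(\mathbb{D},dA)$. The space $A^2_n$ has a reproducing kernel: for each $z\in\mathbb{D}$ there is a (unique) $K_z\in A^2_n$ such that $h(z)=\langle h,K_z\rangle=\int_{\mathbb{D}}h\,\overline{K_z}\,dA$ for all $h\in A^2_n$. Let $k_z=K_z/\|K_z\|$. For $f\in L^1(\mathbb{D},dA)$, the Berezin transform of $f$ is $$Bf(z)=\int_{\mathbb{D}}f(w)\,|k_z(w)|^2\,dA(w)\qquad(z\in\mathbb{D}),$$ and the Toeplitz operator $T_f$ is given on finite linear combinations $h$ of kernel functions $K_\zeta$ ($\zeta\in\mathbb{D}$) by $$(T_fh)(z)=\int_{\mathbb{D}}f(w)\,h(w)\,\overline{K_z(w)}\,dA(w)\qquad(z\in\mathbb{D}).$$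 We say that $T_f$ is compact on $A^2_n$ if it is bounded (that is, for some constant $C$, $T_fh\in A^2_n$ and $\|T_fh\|\le C\|h\|$ for all such $h$, so that $T_f$ extends to a bounded linear operator on $A^2_n$) and this extension is a compact operator. Theorem. Let $n\ge 1$ and let $f\in L^1(\mathbb{D},dA)$ be non-negative. Then $T_f$ is compact on $A^2_n$ if and only if $Bf(z)\to 0$ as $|z|\uparrow 1$. -/

import Mathlib

open MeasureTheory Filter Topology

noncomputable section

namespace PolyBergman

/-- The open unit disk of the complex plane. -/
def unitDisk : Set ℂ := Metric.ball 0 1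

/-- The normalized area measure `dA` on the unit disk. -/
def area : Measure ℂ := ENNReal.ofReal Real.pi⁻¹ • volume.restrict unitDisk

/-- The Wirtinger derivative `∂h/∂z̄ = (∂h/∂x + i ∂h/∂y) / 2`. -/
def dbar (h : ℂ → ℂ) (z : ℂ) : ℂ :=
  (1 / 2 : ℂ) * (fderiv ℝ h z 1 + Complex.I * fderiv ℝ h z Complex.I)

/-- `h` is `n`-analytic on the unit disk: it is of class `C^n` there, and its `n`-th iterated
`z̄`-derivative vanishes there. -/
def IsPolyanalytic (n : ℕ) (h : ℂ → ℂ) : Prop :=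
  ContDiffOn ℝ n h unitDisk ∧ ∀ z ∈ unitDisk, dbar^[n] h z = 0

theorem isOpen_unitDisk : IsOpen unitDisk := Metric.isOpen_ball

theorem dbar_congr {g h : ℂ → ℂ} (e : Set.EqOn g h unitDisk) :
    Set.EqOn (dbar g) (dbar h) unitDisk := by
  intro z hz
  have hgh : g =ᶠ[𝓝 z] h := e.eventuallyEq_of_mem (isOpen_unitDisk.mem_nhds hz)
  simp only [dbar, hgh.fderiv_eq]

theorem dbar_iterate_congr (n : ℕ) : ∀ {g h : ℂ → ℂ}, Set.EqOn g h unitDisk →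
    Set.EqOn (dbar^[n] g) (dbar^[n] h) unitDisk := by
  induction n with
  | zero => intro g h e; simpa using e
  | succ k ih => intro g h e; simpa using ih (dbar_congr e)

theorem contDiffOn_dbar {n : ℕ} {h : ℂ → ℂ} (hh : ContDiffOn ℝ (n + 1 : ℕ) h unitDisk) :
    ContDiffOn ℝ n (dbar h) unitDisk := by
  have hf : ContDiffOn ℝ n (fderiv ℝ h) unitDisk :=
    hh.fderiv_of_isOpen isOpen_unitDisk (by norm_cast)
  have h1 := hf.clm_apply (contDiffOn_const (c := (1 : ℂ)))
  have h2 := hf.clm_apply (contDiffOn_const (c := Complex.I))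
  exact contDiffOn_const.mul (h1.add (contDiffOn_const.mul h2))

theorem dbar_add_smul {g h : ℂ → ℂ} (c : ℂ) (hg : DifferentiableOn ℝ g unitDisk)
    (hh : DifferentiableOn ℝ h unitDisk) :
    Set.EqOn (dbar (g + c • h)) (dbar g + c • dbar h) unitDisk := by
  intro z hz
  have hn := isOpen_unitDisk.mem_nhds hz
  have dg := hg.differentiableAt hn
  have dh := hh.differentiableAt hn
  have e : fderiv ℝ (g + c • h) z = fderiv ℝ g z + c • fderiv ℝ h z := by
    rw [fderiv_add dg (dh.const_smul c), fderiv_const_smul dh]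
  simp only [dbar, e, Pi.add_apply, Pi.smul_apply, add_apply, smul_apply, smul_eq_mul]
  ring

theorem dbar_iterate_add_smul (c : ℂ) (n : ℕ) : ∀ {g h : ℂ → ℂ},
    ContDiffOn ℝ n g unitDisk → ContDiffOn ℝ n h unitDisk →
    Set.EqOn (dbar^[n] (g + c • h)) (dbar^[n] g + c • dbar^[n] h) unitDisk := by
  induction n with
  | zero => intro g h _ _ z _; rfl
  | succ k ih =>
    intro g h hg hh z hz
    have e := dbar_add_smul c (hg.differentiableOn (by simp)) (hh.differentiableOn (by simp))
    simp only [Function.iterate_succ, Function.comp_apply]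
    rw [dbar_iterate_congr k e hz]
    exact ih (contDiffOn_dbar hg) (contDiffOn_dbar hh) hz

theorem isPolyanalytic_zero (n : ℕ) : IsPolyanalytic n 0 := by
  refine ⟨contDiffOn_const, fun z _ => ?_⟩
  have hd : dbar (0 : ℂ → ℂ) = 0 := by
    funext w; simp [dbar]
  rw [Function.iterate_fixed hd n]
  rfl

theorem IsPolyanalytic.add_smul {n : ℕ} {g h : ℂ → ℂ} (c : ℂ) (hg : IsPolyanalytic n g)
    (hh : IsPolyanalytic n h) : IsPolyanalytic n (g + c • h) := by
  refine ⟨hg.1.add (hh.1.const_smul c), fun z hz => ?_⟩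
  rw [dbar_iterate_add_smul c n hg.1 hh.1 hz]
  simp [hg.2 z hz, hh.2 z hz]

/-- The functions that are `n`-analytic on the unit disk and square integrable there.
(The values outside of the disk are irrelevant.) -/
def bergmanFun (n : ℕ) : Submodule ℂ (ℂ → ℂ) where
  carrier := {h | IsPolyanalytic n h ∧ MemLp h 2 area}
  zero_mem' := ⟨isPolyanalytic_zero n, MemLp.zero⟩
  add_mem' := by
    rintro g h ⟨hg, hg'⟩ ⟨hh, hh'⟩
    exact ⟨by simpa using hg.add_smul 1 hh, hg'.add hh'⟩
  smul_mem' := by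
    rintro c h ⟨hh, hh'⟩
    exact ⟨by simpa using (isPolyanalytic_zero n).add_smul c hh, hh'.const_smul c⟩

/-- The class in `L²(𝔻, dA)` of a function in `bergmanFun n`. -/
def toL2 (n : ℕ) : bergmanFun n →ₗ[ℂ] Lp ℂ 2 area where
  toFun h := h.2.2.toLp h.1
  map_add' _ _ := rfl
  map_smul' _ _ := rfl

/-- The `n`-analytic Bergman space `A²_n`, a subspace of `L²(𝔻, dA)` with the norm and the inner
product of `L²(𝔻, dA)`. -/
abbrev bergmanSpace (n : ℕ) : Submodule ℂ (Lp ℂ 2 area) := LinearMap.range (toL2 n)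

/-- A function in `bergmanFun n`, as a vector of the space `A²_n`. -/
def toBergman (n : ℕ) : bergmanFun n →ₗ[ℂ] bergmanSpace n := (toL2 n).rangeRestrict

/-- `g` belongs to `A²_n` and represents the evaluation at `z`:
`h(z) = ⟨h, g⟩ = ∫ h ḡ dA` for all `h` in `A²_n`. -/
def IsReproducingAt (n : ℕ) (z : ℂ) (g : ℂ → ℂ) : Prop :=
  g ∈ bergmanFun n ∧ ∀ h ∈ bergmanFun n, h z = ∫ w, h w * starRingEnd ℂ (g w) ∂area

open Classical in
/-- The reproducing kernel function `K_z` of `A²_n`, as a function `w ↦ K_z(w)`. For `z` in the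
disk, its values on the disk are uniquely determined by `IsReproducingAt`. -/
def kernel (n : ℕ) (z : ℂ) : ℂ → ℂ :=
  if hg : ∃ g, IsReproducingAt n z g then hg.choose else 0

theorem kernel_mem (n : ℕ) (z : ℂ) : kernel n z ∈ bergmanFun n := by
  unfold kernel
  split_ifs with hg
  · exact hg.choose_spec.1
  · exact (bergmanFun n).zero_mem

/-- The normalized kernel function `k_z = K_z / ‖K_z‖`, with the norm of `L²(𝔻, dA)`. -/
def normalizedKernel (n : ℕ) (z w : ℂ) : ℂ :=
  kernel n z w / (Real.sqrt (∫ v, ‖kernel n z v‖ ^ 2 ∂area) : ℂ)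

/-- The Berezin transform `Bf(z) = ∫ f |k_z|² dA`. -/
def berezin (n : ℕ) (f : ℂ → ℂ) (z : ℂ) : ℂ :=
  ∫ w, f w * ((‖normalizedKernel n z w‖ ^ 2 : ℝ) : ℂ) ∂area

/-- The Toeplitz integral `(T_f h)(z) = ∫ f(w) h(w) conj(K_z(w)) dA(w)`. -/
def toeplitz (n : ℕ) (f h : ℂ → ℂ) (z : ℂ) : ℂ :=
  ∫ w, f w * h w * starRingEnd ℂ (kernel n z w) ∂area

/-- The space of the linear combinations of the kernel functions `K_z`, `z` in the disk. -/
def kernelSpan (n : ℕ) : Submodule ℂ (ℂ → ℂ) :=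
  Submodule.span ℂ (kernel n '' unitDisk)

theorem kernelSpan_le (n : ℕ) : kernelSpan n ≤ bergmanFun n := by
  refine Submodule.span_le.2 ?_
  rintro _ ⟨z, _, rfl⟩
  exact kernel_mem n z

/-- The bounded operator `T` on `A²_n` is the extension of `T_f`: for every linear combination
`h` of kernel functions, the function `T_f h` belongs to `A²_n`, and `T h = T_f h`. -/
def ExtendsToeplitz (n : ℕ) (f : ℂ → ℂ) (T : bergmanSpace n →L[ℂ] bergmanSpace n) : Prop :=
  ∀ (h : ℂ → ℂ) (hh : h ∈ kernelSpan n), ∃ hg : toeplitz n f h ∈ bergmanFun n,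
    T (toBergman n ⟨h, kernelSpan_le n hh⟩) = toBergman n ⟨toeplitz n f h, hg⟩

/-- `T_f` is compact on `A²_n`: it is bounded, that is, it extends from the linear combinations of
kernel functions to a bounded operator on `A²_n`, and this operator is compact. -/
def IsCompactToeplitz (n : ℕ) (f : ℂ → ℂ) : Prop :=
  ∃ T : bergmanSpace n →L[ℂ] bergmanSpace n, ExtendsToeplitz n f T ∧ IsCompactOperator T

end PolyBergman

end

namespace PolyBergman

open ComplexConjugate
open scoped ENNReal

/-! An n-analytic function is a polynomial in z̄ of degree below n with holomorphic coefficients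
(`isPolyanalytic_iff_isConjPolynomial`). Its averages over circles about 0 are therefore polynomials
of degree below n in the squared radius, with constant term h(0). If q has degree below n and ∫ p q
= p(0) on [0,1] for all such p, then integration against q(|w|²) reproduces h(0). Weighted
composition with the disk automorphism φ_a preserves n-analyticity and is a multiple of a unitary
involution, so it carries this kernel to any point a. Thus K_a is explicit, ‖K_a‖² = q(0)/(1-|a|²)²,
and |k_a|² = J q(|φ_a|²)²/q(0), where J is the Jacobian of φ_a.

Sufficiency. The kernel may vanish, but q(0) > 0, so on a small pseudohyperbolic disk about u the
function |k_u(w)|² dominates a multiple of (1-|w|²)⁻² (`exists_pseudoDisk_le_normalizedKernel`).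
Combined with a sub-mean value inequality on disks of the same radius and Tonelli, smallness of Bf
near the boundary gives ∫_{|w|≥R} f|h|² ≤ ε‖h‖² (`exists_setLIntegral_le_of_tendsto_berezin`).
Cutting f off to |w| < R gives compact operators, namely integrals of rank one operators built from
K_w. The estimate makes them norm-Cauchy as R → 1; the limit is compact and agrees with T_f on
kernel functions.

Necessity. The vectors (1-|z|²)K_z have constant norm, and Bf(z) is the quadratic form of T_f on
them divided by q(0). Compactness keeps their images in a compact set. Pairing an image with K_ζ
gives the conjugate of (1-|z|²)(T_f K_ζ)(z), which tends to 0 because T_f K_ζ lies in A²_n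
(`tendsto_mul_apply_toBoundary`). Hence 0 is the only cluster point of the images, and Bf → 0 by
Cauchy–Schwarz. -/

theorem mem_unitDisk {z : ℂ} : z ∈ unitDisk ↔ ‖z‖ < 1 := by
  simp [unitDisk]

/-! ### Polyanalytic functions as polynomials in z̄ with holomorphic coefficients. -/

/-- `h` is a polynomial in `z̄` of degree less than `n` with holomorphic coefficients on the disk. -/
def IsConjPolynomial (n : ℕ) (h : ℂ → ℂ) : Prop :=
  ∃ F : ℕ → ℂ → ℂ, (∀ j, DifferentiableOn ℂ (F j) unitDisk) ∧
    ∀ z ∈ unitDisk, h z = ∑ j ∈ Finset.range n, conj z ^ j * F j z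

theorem dbar_mul {g h : ℂ → ℂ} {z : ℂ} (hg : DifferentiableAt ℝ g z)
    (hh : DifferentiableAt ℝ h z) :
    dbar (fun w => g w * h w) z = dbar g z * h z + g z * dbar h z := by
  simp only [dbar, fderiv_fun_mul hg hh, add_apply, smul_apply, smul_eq_mul]
  ring

theorem dbar_sum {ι : Type*} (s : Finset ι) {g : ι → ℂ → ℂ} {z : ℂ}
    (hg : ∀ i ∈ s, DifferentiableAt ℝ (g i) z) :
    dbar (fun w => ∑ i ∈ s, g i w) z = ∑ i ∈ s, dbar (g i) z := by
  simp only [dbar, fderiv_fun_sum hg, sum_apply, Finset.mul_sum,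
    Finset.sum_add_distrib, mul_add]

theorem dbar_eq_zero {g : ℂ → ℂ} {z : ℂ} (hg : DifferentiableAt ℂ g z) : dbar g z = 0 := by
  have := (differentiableAt_complex_iff_differentiableAt_real.1 hg).2
  rw [dbar, this, smul_eq_mul, ← mul_assoc, Complex.I_mul_I]
  ring

theorem differentiableAt_of_dbar_eq_zero {g : ℂ → ℂ} {z : ℂ} (hg : DifferentiableAt ℝ g z)
    (h : dbar g z = 0) : DifferentiableAt ℂ g z := by
  refine differentiableAt_complex_iff_differentiableAt_real.2 ⟨hg, ?_⟩
  have h' : fderiv ℝ g z 1 + Complex.I * fderiv ℝ g z Complex.I = 0 := by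
    simpa [dbar] using h
  rw [smul_eq_mul]
  linear_combination (-Complex.I) * h' + fderiv ℝ g z Complex.I * Complex.I_mul_I

theorem differentiable_conj_pow (j : ℕ) : Differentiable ℝ (fun w : ℂ => conj w ^ j) :=
  Complex.differentiable_conj.pow j

theorem dbar_conj_pow (j : ℕ) (z : ℂ) :
    dbar (fun w => conj w ^ j) z = j * conj z ^ (j - 1) := by
  have h1 : dbar (fun w => conj w) z = 1 := by
    have : fderiv ℝ (fun w : ℂ => conj w) z = (Complex.conjCLE : ℂ →L[ℝ] ℂ) :=
      Complex.conjCLE.hasFDerivAt.fderiv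
    simp only [dbar, this]
    simp
    norm_num
  induction j with
  | zero => simpa using dbar_eq_zero (differentiableAt_const (1 : ℂ))
  | succ k ih =>
    have := dbar_mul (g := fun w => conj w ^ k) (h := fun w => conj w) (z := z)
      (differentiable_conj_pow k z) (Complex.differentiable_conj z)
    simp only [pow_succ]
    rw [this, ih, h1]
    rcases k with _ | k
    · simp
    · simp [pow_succ]
      ring

theorem dbar_conj_pow_mul {F : ℂ → ℂ} {z : ℂ} (j : ℕ) (hF : DifferentiableAt ℂ F z) :
    dbar (fun w => conj w ^ j * F w) z = j * conj z ^ (j - 1) * F z := by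
  rw [dbar_mul (differentiable_conj_pow j z) (hF.restrictScalars ℝ), dbar_eq_zero hF,
    dbar_conj_pow]
  ring

theorem dbar_sum_conj_pow {F : ℕ → ℂ → ℂ} {z : ℂ} (n : ℕ)
    (hF : ∀ j, DifferentiableAt ℂ (F j) z) :
    dbar (fun w => ∑ j ∈ Finset.range (n + 1), conj w ^ j * F j w) z =
      ∑ j ∈ Finset.range n, conj z ^ j * ((j + 1 : ℂ) * F (j + 1) z) := by
  rw [dbar_sum (g := fun j w => conj w ^ j * F j w) _ fun j _ =>
    (differentiable_conj_pow j z).mul ((hF j).restrictScalars ℝ)]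
  rw [Finset.sum_range_succ', dbar_conj_pow_mul 0 (hF 0)]
  simp only [Nat.cast_zero, zero_mul, add_zero]
  refine Finset.sum_congr rfl fun j _ => ?_
  rw [dbar_conj_pow_mul _ (hF _)]
  push_cast
  ring

theorem contDiffOn_sum_conj_pow {F : ℕ → ℂ → ℂ} (hF : ∀ j, DifferentiableOn ℂ (F j) unitDisk)
    (n m : ℕ) :
    ContDiffOn ℝ m (fun w => ∑ j ∈ Finset.range n, conj w ^ j * F j w) unitDisk := by
  refine ContDiffOn.sum fun j _ => ?_
  refine ContDiffOn.mul ?_ (((hF j).contDiffOn isOpen_unitDisk).restrict_scalars ℝ)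
  exact (Complex.conjCLE.contDiff.pow j).contDiffOn

/-- Induction on n. A polynomial in z̄ with holomorphic coefficients can be integrated term by term
in z̄; subtracting such an antiderivative of ∂h/∂z̄ from h leaves a holomorphic function, which
becomes the coefficient of z̄⁰. Conversely, each ∂/∂z̄ lowers the degree in z̄ by one. -/
theorem isPolyanalytic_iff_isConjPolynomial {n : ℕ} {h : ℂ → ℂ} :
    IsPolyanalytic n h ↔ IsConjPolynomial n h := by
  constructor
  · induction n generalizing h with
    | zero =>
      rintro ⟨-, h0⟩
      exact ⟨0, fun _ => differentiableOn_const 0, fun z hz => by simpa using h0 z hz⟩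
    | succ n ih =>
      rintro ⟨hc, h0⟩
      obtain ⟨G, hG, hGe⟩ := ih (h := dbar h) ⟨contDiffOn_dbar hc, fun z hz => by
        simpa using h0 z hz⟩
      -- Coefficients of the z̄-antiderivative S of ∂h/∂z̄: z̄^(j-1) integrates to z̄^j / j. The
      -- zero placed at index 0 is later replaced by the holomorphic remainder h - S.
      let E : ℕ → ℂ → ℂ := fun j => if j = 0 then 0 else fun z => (j : ℂ)⁻¹ * G (j - 1) z
      have hE : ∀ j, DifferentiableOn ℂ (E j) unitDisk := by
        intro j
        rcases j with _ | j
        · exact differentiableOn_const 0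
        · exact (hG j).const_mul _
      let S : ℂ → ℂ := fun w => ∑ j ∈ Finset.range (n + 1), conj w ^ j * E j w
      have hS : ContDiffOn ℝ (n + 1 : ℕ) S unitDisk := contDiffOn_sum_conj_pow hE _ _
      have hh' : DifferentiableOn ℝ h unitDisk := hc.differentiableOn (by simp)
      have hS' : DifferentiableOn ℝ S unitDisk := hS.differentiableOn (by simp)
      have hu : DifferentiableOn ℂ (h + (-1 : ℂ) • S) unitDisk := by
        intro z hz
        have hn := isOpen_unitDisk.mem_nhds hz
        refine (differentiableAt_of_dbar_eq_zero ?_ ?_).differentiableWithinAt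
        · exact (hh'.differentiableAt hn).add ((hS'.differentiableAt hn).const_smul _)
        · rw [dbar_add_smul _ hh' hS' hz]
          simp only [Pi.add_apply, Pi.smul_apply]
          rw [hGe z hz, dbar_sum_conj_pow n fun j => (hE j).differentiableAt hn]
          rw [Finset.smul_sum, ← Finset.sum_add_distrib]
          refine Finset.sum_eq_zero fun j _ => ?_
          have : (j + 1 : ℂ) ≠ 0 := by exact_mod_cast Nat.succ_ne_zero j
          simp [E]
          field_simp
          ring
      refine ⟨fun j => if j = 0 then h + (-1 : ℂ) • S else E j, fun j => ?_, fun z hz => ?_⟩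
      · rcases j with _ | j
        · exact hu
        · exact hE (j + 1)
      · have hS0 : S z = ∑ j ∈ Finset.range n, conj z ^ (j + 1) * E (j + 1) z := by
          simp only [S]
          rw [Finset.sum_range_succ']
          simp [E]
        rw [Finset.sum_range_succ']
        simp [hS0]
  · rintro ⟨F, hF, he⟩
    refine ⟨(contDiffOn_sum_conj_pow hF n n).congr he, fun z hz => ?_⟩
    rw [dbar_iterate_congr n he hz]
    clear he
    induction n generalizing F z with
    | zero => simp
    | succ n ih =>
      rw [Function.iterate_succ, Function.comp_apply]
      have hd : Set.EqOn (dbar fun w => ∑ j ∈ Finset.range (n + 1), conj w ^ j * F j w)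
          (fun z => ∑ j ∈ Finset.range n, conj z ^ j * ((j + 1 : ℂ) * F (j + 1) z)) unitDisk :=
        fun z hz => dbar_sum_conj_pow n fun j =>
          (hF j).differentiableAt (isOpen_unitDisk.mem_nhds hz)
      rw [dbar_iterate_congr n hd hz]
      exact ih (fun j z => (j + 1 : ℂ) * F (j + 1) z) (fun j => (hF _).const_mul _) z hz

namespace IsConjPolynomial

theorem zero (n : ℕ) : IsConjPolynomial n 0 :=
  ⟨0, fun _ => differentiableOn_const 0, fun z _ => by simp⟩

theorem congr {n : ℕ} {g h : ℂ → ℂ} (hg : IsConjPolynomial n g) (e : Set.EqOn h g unitDisk) :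
    IsConjPolynomial n h := by
  obtain ⟨F, hF, he⟩ := hg
  exact ⟨F, hF, fun z hz => (e hz).trans (he z hz)⟩

theorem of_differentiableOn {h : ℂ → ℂ} (hh : DifferentiableOn ℂ h unitDisk) :
    IsConjPolynomial 1 h :=
  ⟨fun _ => h, fun _ => hh, fun z _ => by simp⟩

theorem add {n : ℕ} {g h : ℂ → ℂ} (hg : IsConjPolynomial n g) (hh : IsConjPolynomial n h) :
    IsConjPolynomial n (fun z => g z + h z) := by
  obtain ⟨F, hF, he⟩ := hg
  obtain ⟨G, hG, he'⟩ := hh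
  refine ⟨fun j z => F j z + G j z, fun j => (hF j).add (hG j), fun z hz => ?_⟩
  simp only [he z hz, he' z hz, mul_add, Finset.sum_add_distrib]

theorem sum {ι : Type*} {n : ℕ} (s : Finset ι) {g : ι → ℂ → ℂ}
    (hg : ∀ i ∈ s, IsConjPolynomial n (g i)) : IsConjPolynomial n (fun z => ∑ i ∈ s, g i z) := by
  classical
  induction s using Finset.induction_on with
  | empty => simpa using! zero n
  | insert i s hi ih =>
    simp only [Finset.sum_insert hi]
    exact (hg i (Finset.mem_insert_self i s)).add
      (ih fun j hj => hg j (Finset.mem_insert_of_mem hj))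

theorem mul_differentiableOn {n : ℕ} {g h : ℂ → ℂ} (hg : IsConjPolynomial n g)
    (hh : DifferentiableOn ℂ h unitDisk) : IsConjPolynomial n (fun z => h z * g z) := by
  obtain ⟨F, hF, he⟩ := hg
  refine ⟨fun j z => h z * F j z, fun j => hh.mul (hF j), fun z hz => ?_⟩
  simp only [he z hz, Finset.mul_sum]
  exact Finset.sum_congr rfl fun j _ => by ring

theorem succ {n : ℕ} {g : ℂ → ℂ} (hg : IsConjPolynomial n g) : IsConjPolynomial (n + 1) g := by
  obtain ⟨F, hF, he⟩ := hg
  refine ⟨fun j => if j = n then 0 else F j, fun j => ?_, fun z hz => ?_⟩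
  · dsimp only
    split_ifs
    · exact differentiableOn_const 0
    · exact hF j
  · rw [he z hz, Finset.sum_range_succ]
    simp only [↓reduceIte, Pi.zero_apply, mul_zero, add_zero]
    refine Finset.sum_congr rfl fun j hj => ?_
    rw [if_neg (Finset.mem_range.1 hj).ne]

theorem conj_mul {n : ℕ} {g : ℂ → ℂ} (hg : IsConjPolynomial n g) :
    IsConjPolynomial (n + 1) (fun z => conj z * g z) := by
  obtain ⟨F, hF, he⟩ := hg
  refine ⟨fun j => if j = 0 then 0 else F (j - 1), fun j => ?_, fun z hz => ?_⟩
  · rcases j with _ | j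
    · exact differentiableOn_const 0
    · exact hF j
  · simp only [he z hz]
    rw [Finset.sum_range_succ', Finset.mul_sum]
    simp [pow_succ']
    exact Finset.sum_congr rfl fun j _ => by ring

theorem linear_conj_mul {n : ℕ} {g : ℂ → ℂ} (a b : ℂ) (hg : IsConjPolynomial n g) :
    IsConjPolynomial (n + 1) (fun z => (a + b * conj z) * g z) := by
  refine ((hg.mul_differentiableOn (differentiableOn_const a)).succ.add
    (hg.conj_mul.mul_differentiableOn (differentiableOn_const b))).congr fun z _ => ?_
  ring

theorem linear_conj_pow_mul {n : ℕ} {g : ℂ → ℂ} (a b : ℂ) (hg : IsConjPolynomial n g) (k : ℕ) :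
    IsConjPolynomial (n + k) (fun z => (a + b * conj z) ^ k * g z) := by
  induction k with
  | zero => simpa using hg
  | succ k ih => exact (ih.linear_conj_mul a b).congr fun z _ => by ring

theorem continuousOn {n : ℕ} {g : ℂ → ℂ} (hg : IsConjPolynomial n g) :
    ContinuousOn g unitDisk :=
  (isPolyanalytic_iff_isConjPolynomial.2 hg).1.continuousOn

end IsConjPolynomial

/-! ### Circle averages, the moment polynomial and the mean value property. -/

/-- Write F = F(0) + zG. On |z| = r one has z̄z = r², so z̄^(j+1) F = F(0) z̄^(j+1) + r² z̄^j G. The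
first term averages to 0, being a multiple of the conjugate of a holomorphic function vanishing at
0, and induction applies to G. What matters is that c does not depend on r. -/
theorem circleAverage_conj_pow_mul {F : ℂ → ℂ} (hF : DifferentiableOn ℂ F unitDisk) (j : ℕ) :
    ∃ c : ℂ, ∀ r : ℝ, 0 < r → r < 1 →
      Real.circleAverage (fun z => conj z ^ j * F z) 0 r = (r : ℂ) ^ (2 * j) * c := by
  have hmean : ∀ {G : ℂ → ℂ}, DifferentiableOn ℂ G unitDisk → ∀ r : ℝ, 0 < r → r < 1 →
      Real.circleAverage G 0 r = G 0 := by
    intro G hG r hr hr'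
    refine circleAverage_of_differentiable_on_off_countable Set.countable_empty ?_ ?_
    · refine hG.continuousOn.mono ?_
      rw [abs_of_pos hr]
      exact Metric.closedBall_subset_ball hr'
    · rintro z ⟨hz, -⟩
      refine hG.differentiableAt (isOpen_unitDisk.mem_nhds ?_)
      rw [abs_of_pos hr] at hz
      exact Metric.ball_subset_ball hr'.le hz
  induction j generalizing F with
  | zero => exact ⟨F 0, fun r hr hr' => by simpa using hmean hF r hr hr'⟩
  | succ j ih =>
    have hG : DifferentiableOn ℂ (dslope F 0) unitDisk :=
      (Complex.differentiableOn_dslope (isOpen_unitDisk.mem_nhds (by simp [unitDisk]))).2 hF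
    obtain ⟨c, hc⟩ := ih hG
    refine ⟨c, fun r hr hr' => ?_⟩
    have hconj : Real.circleAverage (fun z : ℂ => conj z ^ (j + 1)) 0 r = 0 := by
      have h0 := hmean (G := fun z => z ^ (j + 1)) (by fun_prop) r hr hr'
      have := Complex.conjCLE.toContinuousLinearMap.circleAverage_comp_comm
        (f := fun z => z ^ (j + 1)) (c := 0) (R := r)
        (ContinuousOn.circleIntegrable hr.le (by fun_prop))
      simp only [h0] at this
      simpa [Function.comp_def] using this
    have he : Real.circleAverage (fun z => conj z ^ (j + 1) * F z) 0 r =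
        Real.circleAverage ((fun z => F 0 • conj z ^ (j + 1)) +
          fun z => ((r : ℂ) ^ 2) • (conj z ^ j * dslope F 0 z)) 0 r := by
      refine Real.circleAverage_congr_sphere fun z hz => ?_
      have hz' : conj z * z = (r : ℂ) ^ 2 := by
        rw [Complex.conj_mul', mem_sphere_zero_iff_norm.1 hz, abs_of_pos hr]
      have hs := sub_smul_dslope F 0 z
      simp only [sub_zero, smul_eq_mul] at hs
      simp only [Pi.add_apply, smul_eq_mul]
      rw [← hz']
      linear_combination (-conj z ^ (j + 1)) * hs
    have hcG : ContinuousOn (dslope F 0) (Metric.sphere 0 |r|) := by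
      refine hG.continuousOn.mono fun z hz => ?_
      rw [mem_unitDisk, mem_sphere_zero_iff_norm.1 hz, abs_of_pos hr]
      exact hr'
    have hci : ContinuousOn (fun z : ℂ => conj z ^ j) (Metric.sphere 0 |r|) :=
      (differentiable_conj_pow j).continuous.continuousOn
    have hci' : ContinuousOn (fun z : ℂ => conj z ^ (j + 1)) (Metric.sphere 0 |r|) :=
      (differentiable_conj_pow _).continuous.continuousOn
    rw [he, Real.circleAverage_add, Real.circleAverage_fun_smul, Real.circleAverage_fun_smul,
      hconj, hc r hr hr']
    · simp only [smul_eq_mul]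
      ring
    · exact ContinuousOn.circleIntegrable' (hci'.const_smul (F 0))
    · exact ContinuousOn.circleIntegrable' ((hci.mul hcG).const_smul ((r : ℂ) ^ 2))

theorem IsConjPolynomial.circleAverage {n : ℕ} {h : ℂ → ℂ} (hh : IsConjPolynomial n h)
    (hn : 1 ≤ n) :
    ∃ c : ℕ → ℂ, c 0 = h 0 ∧ ∀ r : ℝ, 0 < r → r < 1 →
      Real.circleAverage h 0 r = ∑ j ∈ Finset.range n, (r : ℂ) ^ (2 * j) * c j := by
  obtain ⟨F, hF, he⟩ := hh
  choose c hc using fun j => circleAverage_conj_pow_mul (hF j) j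
  have havg : ∀ r : ℝ, 0 < r → r < 1 →
      Real.circleAverage h 0 r = ∑ j ∈ Finset.range n, (r : ℂ) ^ (2 * j) * c j := by
    intro r hr hr'
    have hsub : Metric.sphere (0 : ℂ) |r| ⊆ unitDisk := by
      intro z hz
      rw [mem_unitDisk, mem_sphere_zero_iff_norm.1 hz, abs_of_pos hr]
      exact hr'
    rw [Real.circleAverage_congr_sphere fun z hz => he z (hsub hz), Real.circleAverage_fun_sum]
    · exact Finset.sum_congr rfl fun j _ => hc j r hr hr'
    · intro j _
      exact ContinuousOn.circleIntegrable'
        ((differentiable_conj_pow j).continuous.continuousOn.mul ((hF j).continuousOn.mono hsub))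
  refine ⟨c, ?_, havg⟩
  have h0 : h 0 = F 0 0 := by
    rw [he 0 (by simp [unitDisk]), Finset.sum_eq_single_of_mem 0 (Finset.mem_range.2 hn)]
    · simp
    · intro j _ hj
      simp [hj]
  rw [h0]
  -- Any radius in (0,1) would do: the exponent 2j is 0 here, so the average of F 0 is the constant
  -- c 0 itself.
  have h1 := hc 0 (1 / 2) (by norm_num) (by norm_num)
  simp only [pow_zero, one_mul, mul_zero] at h1
  rw [← h1]
  refine circleAverage_of_differentiable_on_off_countable Set.countable_empty ?_ ?_
  · refine (hF 0).continuousOn.mono ?_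
    exact Metric.closedBall_subset_ball (by norm_num [abs_of_pos])
  · rintro z ⟨hz, -⟩
    refine (hF 0).differentiableAt (isOpen_unitDisk.mem_nhds ?_)
    exact Metric.ball_subset_ball (by norm_num [abs_of_pos]) hz

theorem eq_zero_of_integral_sq_eq_zero {q : Polynomial ℝ}
    (h : ∫ t in (0 : ℝ)..1, q.eval t * q.eval t = 0) : q = 0 := by
  by_contra hq
  have hc : Continuous fun t => q.eval t := q.continuous
  obtain ⟨c, hc01, hne⟩ : ∃ c ∈ Set.Icc (0 : ℝ) 1, q.eval c ≠ 0 := by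
    by_contra! h0
    refine hq (Polynomial.eq_zero_of_infinite_isRoot q ?_)
    exact (Set.Icc_infinite (zero_lt_one' ℝ)).mono fun t ht => h0 t ht
  have : 0 < ∫ t in (0 : ℝ)..1, q.eval t * q.eval t := by
    refine intervalIntegral.integral_pos one_pos (by fun_prop) (fun t _ => mul_self_nonneg _) ?_
    exact ⟨c, hc01, mul_self_pos.2 hne⟩
  exact this.ne' h

theorem eval_eq_sum_range_of_mem_degreeLT {n : ℕ} {p : Polynomial ℝ}
    (hp : p ∈ Polynomial.degreeLT ℝ n) (t : ℝ) :
    p.eval t = ∑ k ∈ Finset.range n, p.coeff k * t ^ k := by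
  rcases eq_or_ne p 0 with rfl | h0
  · simp
  · exact Polynomial.eval_eq_sum_range' ((Polynomial.natDegree_lt_iff_degree_lt h0).2
      (Polynomial.mem_degreeLT.1 hp)) t

theorem integral_mul_eval {n : ℕ} {p : Polynomial ℝ} (hp : p ∈ Polynomial.degreeLT ℝ n)
    (q : Polynomial ℝ) :
    ∫ t in (0 : ℝ)..1, p.eval t * q.eval t =
      ∑ k ∈ Finset.range n, p.coeff k * ∫ t in (0 : ℝ)..1, t ^ k * q.eval t := by
  have he : ∀ t : ℝ, p.eval t * q.eval t =
      ∑ k ∈ Finset.range n, p.coeff k * (t ^ k * q.eval t) := by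
    intro t
    rw [eval_eq_sum_range_of_mem_degreeLT hp, Finset.sum_mul]
    exact Finset.sum_congr rfl fun k _ => by ring
  simp_rw [he]
  rw [intervalIntegral.integral_finsetSum]
  · simp_rw [intervalIntegral.integral_const_mul]
  · intro k _
    exact Continuous.intervalIntegrable (by fun_prop) _ _

/-- The map sending q to its first n moments is injective on polynomials of degree below n: if all
these moments vanish, q is orthogonal to itself. Source and target both have dimension n, so the map
is onto. -/
theorem exists_momentPolynomial (n : ℕ) : ∃ q ∈ Polynomial.degreeLT ℝ n,
    ∀ k < n, ∫ t in (0 : ℝ)..1, t ^ k * q.eval t = if k = 0 then 1 else 0 := by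
  let L : Polynomial.degreeLT ℝ n →ₗ[ℝ] (Fin n → ℝ) :=
    { toFun := fun q k => ∫ t in (0 : ℝ)..1, t ^ (k : ℕ) * q.1.eval t
      map_add' := fun p q => by
        funext k
        simp only [Submodule.coe_add, Polynomial.eval_add, mul_add, Pi.add_apply]
        exact intervalIntegral.integral_add
          (Continuous.intervalIntegrable (by fun_prop) _ _)
          (Continuous.intervalIntegrable (by fun_prop) _ _)
      map_smul' := fun c q => by
        funext k
        simp only [Submodule.coe_smul, Polynomial.eval_smul, smul_eq_mul, RingHom.id_apply,
          Pi.smul_apply, ← intervalIntegral.integral_const_mul]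
        congr 1
        funext t
        ring }
  have : Module.Finite ℝ (Polynomial.degreeLT ℝ n) :=
    Module.Finite.equiv (Polynomial.degreeLTEquiv ℝ n).symm
  have hL : Function.Injective L := by
    rw [injective_iff_map_eq_zero]
    rintro ⟨q, hq⟩ h0
    refine Subtype.ext (eq_zero_of_integral_sq_eq_zero ?_)
    rw [integral_mul_eval hq]
    refine Finset.sum_eq_zero fun k hk => ?_
    have := congrFun h0 ⟨k, Finset.mem_range.1 hk⟩
    simp only [L, LinearMap.coe_mk, AddHom.coe_mk, Pi.zero_apply] at this
    rw [this, mul_zero]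
  have hs : Function.Surjective L :=
    (LinearMap.injective_iff_surjective_of_finrank_eq_finrank
      (Polynomial.degreeLTEquiv ℝ n).finrank_eq).1 hL
  obtain ⟨q, hq⟩ := hs fun k => if (k : ℕ) = 0 then 1 else 0
  exact ⟨q.1, q.2, fun k hk => congrFun hq ⟨k, hk⟩⟩

/-- The polynomial `q` of degree less than `n` with `∫ p q = p(0)` on `[0, 1]` for all
polynomials `p` of degree less than `n`. -/
noncomputable def momentPolynomial (n : ℕ) : Polynomial ℝ := (exists_momentPolynomial n).choose

theorem momentPolynomial_mem (n : ℕ) : momentPolynomial n ∈ Polynomial.degreeLT ℝ n :=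
  (exists_momentPolynomial n).choose_spec.1

theorem integral_pow_mul_momentPolynomial {n k : ℕ} (hk : k < n) :
    ∫ t in (0 : ℝ)..1, t ^ k * (momentPolynomial n).eval t = if k = 0 then 1 else 0 :=
  (exists_momentPolynomial n).choose_spec.2 k hk

/-- Testing the reproducing property of q on q itself gives q(0) = ∫ q², and q ≠ 0 because its
zeroth moment is 1. This positivity is what keeps the kernel away from 0 near the diagonal. -/
theorem momentPolynomial_eval_zero_pos {n : ℕ} (hn : 1 ≤ n) :
    0 < (momentPolynomial n).eval 0 := by
  have h1 : ∫ t in (0 : ℝ)..1, (momentPolynomial n).eval t * (momentPolynomial n).eval t =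
      (momentPolynomial n).eval 0 := by
    rw [integral_mul_eval (momentPolynomial_mem n), Finset.sum_eq_single_of_mem 0
      (Finset.mem_range.2 hn), integral_pow_mul_momentPolynomial hn,
      Polynomial.coeff_zero_eq_eval_zero]
    · simp
    · intro k hk h0
      rw [integral_pow_mul_momentPolynomial (Finset.mem_range.1 hk), if_neg h0, mul_zero]
  have h2 : 0 ≤ (momentPolynomial n).eval 0 := by
    rw [← h1]
    exact intervalIntegral.integral_nonneg zero_le_one fun t _ => mul_self_nonneg _
  refine h2.lt_of_ne' fun h0 => ?_
  have := integral_pow_mul_momentPolynomial (n := n) hn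
  rw [eq_zero_of_integral_sq_eq_zero (h1.trans h0)] at this
  simp at this

theorem setIntegral_ball_eq_integral_circleAverage {g : ℂ → ℂ} {r : ℝ} (hr : 0 < r)
    (hc : ContinuousOn g (Metric.ball 0 r)) (hg : IntegrableOn g (Metric.ball 0 r)) :
    ∫ v in Metric.ball 0 r, g v =
      ∫ s in (0 : ℝ)..r, (2 * Real.pi * s) • Real.circleAverage g 0 s := by
  let f : ℂ → ℂ := (Metric.ball 0 r).indicator g
  have hfm : Measurable f := by
    classical
    have := hc.measurable_piecewise (g := 0) (s := Metric.ball 0 r)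
      continuousOn_const Metric.isOpen_ball.measurableSet
    rwa [Set.piecewise_eq_indicator] at this
  have hfi : Integrable f := (integrable_indicator_iff Metric.isOpen_ball.measurableSet).2 hg
  have hF : Measurable fun p : ℝ × ℝ => p.1 • f (Complex.polarCoord.symm p) := by
    refine measurable_fst.smul (hfm.comp ?_)
    have : (Complex.polarCoord.symm : ℝ × ℝ → ℂ) =
        fun p => p.1 * (Real.cos p.2 + Real.sin p.2 * Complex.I) :=
      funext Complex.polarCoord_symm_apply
    rw [this]
    fun_prop
  -- Fubini needs integrability in polar coordinates; it comes from the polar formula for the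
  -- nonnegative integrand ‖f‖.
  have hF' : IntegrableOn (fun p : ℝ × ℝ => p.1 • f (Complex.polarCoord.symm p))
      (Set.Ioi 0 ×ˢ Set.Ioo (-Real.pi) Real.pi) (volume.prod volume) := by
    refine ⟨hF.aestronglyMeasurable, ?_⟩
    have := Complex.lintegral_comp_polarCoord_symm fun v => ‖f v‖ₑ
    rw [HasFiniteIntegral]
    refine lt_of_eq_of_lt ?_ hfi.2
    rw [← this]
    refine setLIntegral_congr_fun polarCoord.open_target.measurableSet fun p hp => ?_
    have hp1 : (0 : ℝ) < p.1 := hp.1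
    simp only [enorm_smul, smul_eq_mul]
    rw [Real.enorm_of_nonneg hp1.le]
  have hcm : ∀ s θ : ℝ, Complex.polarCoord.symm (s, θ) = circleMap 0 s θ := by
    intro s θ
    rw [Complex.polarCoord_symm_apply, circleMap, zero_add, Complex.exp_mul_I]
    simp
  rw [← integral_indicator Metric.isOpen_ball.measurableSet,
    ← Complex.integral_comp_polarCoord_symm]
  have htar : polarCoord.target = Set.Ioi (0 : ℝ) ×ˢ Set.Ioo (-Real.pi) Real.pi := rfl
  rw [htar, Measure.volume_eq_prod, setIntegral_prod _ hF']
  have hin : ∀ s ∈ Set.Ioi (0 : ℝ), (∫ θ in Set.Ioo (-Real.pi) Real.pi,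
      s • f (Complex.polarCoord.symm (s, θ))) =
        (Set.Ioo 0 r).indicator (fun s => (2 * Real.pi * s) • Real.circleAverage g 0 s) s := by
    intro s hs
    have hs' : (0 : ℝ) < s := hs
    simp_rw [hcm]
    by_cases hsr : s < r
    · rw [Set.indicator_of_mem (show s ∈ Set.Ioo 0 r from ⟨hs, hsr⟩)]
      have hfe : ∀ θ : ℝ, f (circleMap 0 s θ) = g (circleMap 0 s θ) := by
        intro θ
        refine Set.indicator_of_mem ?_ _
        simpa [abs_of_pos hs'] using hsr
      simp_rw [hfe]
      rw [Real.circleAverage_eq_integral_add (-Real.pi), integral_smul,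
        ← integral_Ioc_eq_integral_Ioo, ← intervalIntegral.integral_of_le
          (by linarith [Real.pi_pos]),
        intervalIntegral.integral_comp_add_right (fun θ => g (circleMap 0 s θ))]
      rw [smul_smul]
      congr 1
      · field_simp
      · congr 1 <;> ring
    · rw [Set.indicator_of_notMem (fun h => hsr h.2)]
      have hfe : ∀ θ : ℝ, f (circleMap 0 s θ) = 0 := by
        intro θ
        refine Set.indicator_of_notMem ?_ _
        simpa [abs_of_pos hs'] using hsr
      simp [hfe]
  rw [setIntegral_congr_fun measurableSet_Ioi hin, setIntegral_indicator measurableSet_Ioo,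
    intervalIntegral.integral_of_le hr.le, integral_Ioc_eq_integral_Ioo]
  congr 2
  ext s
  simp only [Set.mem_inter_iff, Set.mem_Ioi, Set.mem_Ioo]
  tauto

/-- The substitution t = s²/r² turns the integral into π r^(2j+2) times the j-th moment of q on
[0,1]. -/
theorem integral_momentPolynomial_radial {n j : ℕ} (hj : j < n) {r : ℝ} (hr : 0 < r) :
    ∫ s in (0 : ℝ)..r, 2 * Real.pi * s * (momentPolynomial n).eval (s ^ 2 / r ^ 2) * s ^ (2 * j) =
      if j = 0 then Real.pi * r ^ 2 else 0 := by
  have hsub := intervalIntegral.integral_comp_mul_deriv (a := 0) (b := r)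
    (f := fun s => s ^ 2 / r ^ 2) (f' := fun s => 2 * s / r ^ 2)
    (g := fun t => t ^ j * (momentPolynomial n).eval t) (fun s _ => by
      simpa using (hasDerivAt_pow 2 s).div_const (r ^ 2)) (by fun_prop) (by fun_prop)
  have h1 : r ^ 2 / r ^ 2 = 1 := div_self (by positivity)
  simp only [Function.comp_apply, h1] at hsub
  rw [zero_pow two_ne_zero, zero_div, integral_pow_mul_momentPolynomial hj] at hsub
  have : ∀ s : ℝ, 2 * Real.pi * s * (momentPolynomial n).eval (s ^ 2 / r ^ 2) * s ^ (2 * j) =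
      Real.pi * r ^ (2 * j + 2) * ((s ^ 2 / r ^ 2) ^ j *
        (momentPolynomial n).eval (s ^ 2 / r ^ 2) * (2 * s / r ^ 2)) := by
    intro s
    rw [div_pow, ← pow_mul, ← pow_mul, pow_add]
    field_simp
  simp_rw [this]
  rw [intervalIntegral.integral_const_mul, hsub]
  split_ifs with h
  · simp [h]
  · simp

/-- The mean value property of polynomials in `z̄` with holomorphic coefficients. -/
theorem IsConjPolynomial.setIntegral_mul_momentPolynomial {n : ℕ} (hn : 1 ≤ n) {h : ℂ → ℂ}
    (hh : IsConjPolynomial n h) {r : ℝ} (hr : 0 < r) (hr1 : r ≤ 1)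
    (hi : IntegrableOn h (Metric.ball 0 r)) :
    ∫ v in Metric.ball 0 r, h v * ((momentPolynomial n).eval (‖v‖ ^ 2 / r ^ 2) : ℝ) =
      Real.pi * r ^ 2 * h 0 := by
  set q : ℝ → ℝ := fun t => (momentPolynomial n).eval t with hq
  have hqc : Continuous q := (momentPolynomial n).continuous
  have hQ : Continuous fun v : ℂ => ((q (‖v‖ ^ 2 / r ^ 2) : ℝ) : ℂ) := by fun_prop
  have hcon : ContinuousOn (fun v => h v * (q (‖v‖ ^ 2 / r ^ 2) : ℝ)) (Metric.ball 0 r) :=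
    (hh.continuousOn.mono (Metric.ball_subset_ball hr1)).mul hQ.continuousOn
  have hint : IntegrableOn (fun v => h v * (q (‖v‖ ^ 2 / r ^ 2) : ℝ)) (Metric.ball 0 r) := by
    obtain ⟨C, hC⟩ := (isCompact_closedBall (0 : ℂ) r).exists_bound_of_continuousOn
      hQ.continuousOn
    refine Integrable.mul_bdd (c := C) hi hQ.aestronglyMeasurable ?_
    filter_upwards [ae_restrict_mem measurableSet_ball] with v hv
    exact hC v (Metric.ball_subset_closedBall hv)
  rw [setIntegral_ball_eq_integral_circleAverage hr hcon hint]
  obtain ⟨c, hc0, hc⟩ := hh.circleAverage hn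
  -- The weight is constant on each circle, so it multiplies the polynomial in s² given by the
  -- circle average. The moment conditions then kill every term but j = 0.
  have havg : ∀ s ∈ Set.Ioo 0 r, (2 * Real.pi * s) •
      Real.circleAverage (fun v => h v * (q (‖v‖ ^ 2 / r ^ 2) : ℝ)) 0 s =
        ∑ j ∈ Finset.range n, ((2 * Real.pi * s * q (s ^ 2 / r ^ 2) * s ^ (2 * j) : ℝ) : ℂ) *
          c j := by
    rintro s ⟨hs, hsr⟩
    have : Real.circleAverage (fun v => h v * (q (‖v‖ ^ 2 / r ^ 2) : ℝ)) 0 s =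
        Real.circleAverage (fun v => q (s ^ 2 / r ^ 2) • h v) 0 s := by
      refine Real.circleAverage_congr_sphere fun v hv => ?_
      simp only [mem_sphere_zero_iff_norm.1 hv, abs_of_pos hs, Complex.real_smul]
      ring
    rw [this, Real.circleAverage_fun_smul, hc s hs (hsr.trans_le hr1), Finset.smul_sum,
      Finset.smul_sum]
    refine Finset.sum_congr rfl fun j _ => ?_
    simp only [Complex.real_smul]
    push_cast
    ring
  rw [intervalIntegral.integral_of_le hr.le, integral_Ioc_eq_integral_Ioo,
    setIntegral_congr_fun measurableSet_Ioo havg, ← integral_Ioc_eq_integral_Ioo,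
    ← intervalIntegral.integral_of_le hr.le, intervalIntegral.integral_finsetSum]
  · simp_rw [intervalIntegral.integral_mul_const, intervalIntegral.integral_ofReal]
    rw [Finset.sum_eq_single_of_mem 0 (Finset.mem_range.2 hn)]
    · rw [hq, integral_momentPolynomial_radial hn hr, if_pos rfl, hc0]
      push_cast
      ring
    · intro j hj h0
      rw [hq, integral_momentPolynomial_radial (Finset.mem_range.1 hj) hr, if_neg h0]
      simp
  · intro j _
    exact Continuous.intervalIntegrable (by fun_prop) _ _

/-! ### The normalized area measure. -/

theorem measurableSet_unitDisk : MeasurableSet unitDisk := isOpen_unitDisk.measurableSet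

theorem ae_mem_unitDisk : ∀ᵐ w ∂area, w ∈ unitDisk :=
  Measure.ae_smul_measure (ae_restrict_mem measurableSet_unitDisk) _

theorem ofReal_inv_pi_ne_zero : ENNReal.ofReal Real.pi⁻¹ ≠ 0 := by
  simpa using Real.pi_pos

instance : IsProbabilityMeasure area := by
  refine ⟨?_⟩
  rw [area, Measure.smul_apply, Measure.restrict_apply_univ, unitDisk, Complex.volume_ball,
    smul_eq_mul, ENNReal.ofReal_inv_of_pos Real.pi_pos, ENNReal.ofReal_one, one_pow, one_mul]
  have : (NNReal.pi : ℝ≥0∞) = ENNReal.ofReal Real.pi := by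
    rw [← NNReal.coe_real_pi, ENNReal.ofReal_coe_nnreal]
  rw [this]
  exact ENNReal.inv_mul_cancel (by simpa using Real.pi_pos) ENNReal.ofReal_ne_top

theorem integral_area {E : Type*} [NormedAddCommGroup E] [NormedSpace ℝ E] (g : ℂ → E) :
    ∫ w, g w ∂area = Real.pi⁻¹ • ∫ w in unitDisk, g w := by
  rw [area, integral_smul_measure, ENNReal.toReal_ofReal (inv_nonneg.2 Real.pi_pos.le)]

theorem lintegral_area (g : ℂ → ℝ≥0∞) :
    ∫⁻ w, g w ∂area = ENNReal.ofReal Real.pi⁻¹ * ∫⁻ w in unitDisk, g w := by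
  rw [area, lintegral_smul_measure, smul_eq_mul]

theorem integrable_area_iff {E : Type*} [NormedAddCommGroup E] {g : ℂ → E} :
    Integrable g area ↔ IntegrableOn g unitDisk :=
  integrable_smul_measure ofReal_inv_pi_ne_zero ENNReal.ofReal_ne_top

theorem aestronglyMeasurable_area {E : Type*} [TopologicalSpace E]
    [TopologicalSpace.PseudoMetrizableSpace E] {g : ℂ → E} (hg : ContinuousOn g unitDisk) :
    AEStronglyMeasurable g area :=
  (hg.aestronglyMeasurable measurableSet_unitDisk).smul_measure _

/-! ### Disk automorphisms and their change of variables. -/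

/-- The involutive automorphism `w ↦ (a - w) / (1 - ā w)` of the unit disk. -/
noncomputable def mobius (a w : ℂ) : ℂ := (a - w) / (1 - conj a * w)

section mobius

variable {a w : ℂ}

theorem norm_conj_mul_lt_one (ha : a ∈ unitDisk) (hw : w ∈ unitDisk) : ‖conj a * w‖ < 1 := by
  rw [norm_mul, Complex.norm_conj]
  rw [mem_unitDisk] at ha hw
  nlinarith [norm_nonneg a, norm_nonneg w]

theorem one_sub_conj_mul_ne_zero (ha : a ∈ unitDisk) (hw : w ∈ unitDisk) :
    1 - conj a * w ≠ 0 := by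
  intro h
  have := norm_conj_mul_lt_one ha hw
  rw [← sub_eq_zero.1 h] at this
  simp at this

theorem one_sub_norm_le (hw : w ∈ unitDisk) : 1 - ‖a‖ ≤ ‖1 - conj a * w‖ := by
  have h1 := norm_sub_norm_le (1 : ℂ) (conj a * w)
  have h2 : ‖conj a * w‖ ≤ ‖a‖ := by
    rw [norm_mul, Complex.norm_conj]
    exact mul_le_of_le_one_right (norm_nonneg a) (mem_unitDisk.1 hw).le
  rw [norm_one] at h1
  linarith

theorem one_sub_sq_pos (ha : a ∈ unitDisk) : 0 < 1 - ‖a‖ ^ 2 := by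
  rw [mem_unitDisk] at ha
  nlinarith [norm_nonneg a]

theorem one_sub_norm_mobius_sq (ha : a ∈ unitDisk) (hw : w ∈ unitDisk) :
    1 - ‖mobius a w‖ ^ 2 =
      (1 - ‖a‖ ^ 2) * (1 - ‖w‖ ^ 2) / ‖1 - conj a * w‖ ^ 2 := by
  have hne := norm_ne_zero_iff.2 (one_sub_conj_mul_ne_zero ha hw)
  rw [mobius, norm_div, div_pow, eq_div_iff (pow_ne_zero 2 hne), sub_mul,
    div_mul_cancel₀ _ (pow_ne_zero 2 hne)]
  simp only [← Complex.normSq_eq_norm_sq, Complex.normSq_apply]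
  simp
  ring

theorem mobius_mem (ha : a ∈ unitDisk) (hw : w ∈ unitDisk) : mobius a w ∈ unitDisk := by
  have h := one_sub_norm_mobius_sq ha hw
  have : 0 < 1 - ‖mobius a w‖ ^ 2 := by
    rw [h]
    have := norm_pos_iff.2 (one_sub_conj_mul_ne_zero ha hw)
    have := one_sub_sq_pos ha
    have := one_sub_sq_pos hw
    positivity
  rw [mem_unitDisk]
  nlinarith [norm_nonneg (mobius a w)]

theorem one_sub_conj_mul_mobius (ha : a ∈ unitDisk) (hw : w ∈ unitDisk) :
    1 - conj a * mobius a w = (1 - (‖a‖ : ℂ) ^ 2) / (1 - conj a * w) := by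
  have hne := one_sub_conj_mul_ne_zero ha hw
  rw [← Complex.conj_mul', mobius]
  field_simp
  ring

theorem one_sub_sq_ne_zero (ha : a ∈ unitDisk) : (1 - (‖a‖ : ℂ) ^ 2) ≠ 0 := by
  exact_mod_cast (one_sub_sq_pos ha).ne'

theorem mobius_mobius (ha : a ∈ unitDisk) (hw : w ∈ unitDisk) : mobius a (mobius a w) = w := by
  have hne := one_sub_conj_mul_ne_zero ha hw
  have hne' := one_sub_sq_ne_zero ha
  have h := one_sub_conj_mul_mobius ha hw
  rw [mobius, h, div_eq_iff (div_ne_zero hne' hne), mobius, ← Complex.conj_mul',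
    mul_div_assoc', eq_div_iff hne, sub_mul, div_mul_cancel₀ _ hne]
  ring

@[simp]
theorem mobius_zero_right (a : ℂ) : mobius a 0 = a := by simp [mobius]

@[simp]
theorem mobius_self (a : ℂ) : mobius a a = 0 := by simp [mobius]

theorem norm_mobius_comm (a w : ℂ) : ‖mobius a w‖ = ‖mobius w a‖ := by
  rw [mobius, mobius, norm_div, norm_div, norm_sub_rev, ← Complex.norm_conj (1 - conj a * w)]
  congr 2
  simp [mul_comm]

theorem hasDerivAt_mobius (ha : a ∈ unitDisk) (hw : w ∈ unitDisk) :
    HasDerivAt (mobius a) (-(1 - (‖a‖ : ℂ) ^ 2) / (1 - conj a * w) ^ 2) w := by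
  have hne := one_sub_conj_mul_ne_zero ha hw
  have h1 : HasDerivAt (fun w => a - w) (-1) w := by
    simpa using (hasDerivAt_id w).const_sub a
  have h2 : HasDerivAt (fun w => 1 - conj a * w) (-conj a) w := by
    simpa using ((hasDerivAt_id w).const_mul (conj a)).const_sub 1
  refine HasDerivAt.congr_deriv (h1.div h2 hne : HasDerivAt (mobius a) _ w) ?_
  congr 1
  rw [← Complex.conj_mul']
  ring

theorem mobius_image (ha : a ∈ unitDisk) : mobius a '' unitDisk = unitDisk := by
  refine Set.Subset.antisymm ?_ fun w hw => ⟨mobius a w, mobius_mem ha hw, mobius_mobius ha hw⟩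
  rintro _ ⟨w, hw, rfl⟩
  exact mobius_mem ha hw

theorem mobius_injOn (ha : a ∈ unitDisk) : Set.InjOn (mobius a) unitDisk := fun w hw v hv h => by
  rw [← mobius_mobius ha hw, h, mobius_mobius ha hv]

/-- The Jacobian determinant of `mobius a`. -/
noncomputable def mobiusJacobian (a w : ℂ) : ℝ := ((1 - ‖a‖ ^ 2) / ‖1 - conj a * w‖ ^ 2) ^ 2

/-- The real derivative of `mobius a`. -/
noncomputable def mobiusFDeriv (a w : ℂ) : ℂ →L[ℝ] ℂ :=
  (ContinuousLinearMap.toSpanSingleton ℂ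
    (-(1 - (‖a‖ : ℂ) ^ 2) / (1 - conj a * w) ^ 2)).restrictScalars ℝ

theorem hasFDerivWithinAt_mobius (ha : a ∈ unitDisk) (hw : w ∈ unitDisk) :
    HasFDerivWithinAt (mobius a) (mobiusFDeriv a w) unitDisk w :=
  ((hasDerivAt_mobius ha hw).hasFDerivAt.restrictScalars ℝ).hasFDerivWithinAt

/-- The derivative is complex linear, so its real determinant is the squared modulus of the complex
derivative. -/
theorem abs_det_mobiusFDeriv (a w : ℂ) : |(mobiusFDeriv a w).det| = mobiusJacobian a w := by
  have : (mobiusFDeriv a w).det =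
      Complex.normSq (-(1 - (‖a‖ : ℂ) ^ 2) / (1 - conj a * w) ^ 2) := by
    rw [mobiusFDeriv, ContinuousLinearMap.det]
    simp [LinearMap.det_restrictScalars, Algebra.norm_complex_eq]
  rw [this, abs_of_nonneg (Complex.normSq_nonneg _), Complex.normSq_eq_norm_sq, norm_div,
    norm_neg, norm_pow, mobiusJacobian, div_pow, div_pow]
  congr 1
  have : (1 - (‖a‖ : ℂ) ^ 2) = ((1 - ‖a‖ ^ 2 : ℝ) : ℂ) := by push_cast; ring
  rw [this, Complex.norm_real, Real.norm_eq_abs, sq_abs]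

theorem integral_mobius {E : Type*} [NormedAddCommGroup E] [NormedSpace ℝ E] (ha : a ∈ unitDisk)
    (g : ℂ → E) : ∫ v, g v ∂area = ∫ w, mobiusJacobian a w • g (mobius a w) ∂area := by
  have := integral_image_eq_integral_abs_det_fderiv_smul volume measurableSet_unitDisk
    (fun w hw => hasFDerivWithinAt_mobius ha hw) (mobius_injOn ha) g
  simp only [abs_det_mobiusFDeriv, mobius_image ha] at this
  rw [integral_area, integral_area, this]

theorem lintegral_mobius (ha : a ∈ unitDisk) (g : ℂ → ℝ≥0∞) :
    ∫⁻ v, g v ∂area = ∫⁻ w, ENNReal.ofReal (mobiusJacobian a w) * g (mobius a w) ∂area := by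
  have := lintegral_image_eq_lintegral_abs_det_fderiv_mul volume measurableSet_unitDisk
    (fun w hw => hasFDerivWithinAt_mobius ha hw) (mobius_injOn ha) g
  simp only [abs_det_mobiusFDeriv, mobius_image ha] at this
  rw [lintegral_area, lintegral_area, this]

end mobius

/-! ### Weighted composition operators on n-analytic functions. -/

/-- The weight which turns composition with `mobius a` into a multiple of a unitary operator
on the `n`-analytic functions. -/
noncomputable def transportWeight (n : ℕ) (a w : ℂ) : ℂ :=
  (1 - a * conj w) ^ (n - 1) / (1 - conj a * w) ^ (n + 1)

/-- Weighted composition with `mobius a`. -/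
noncomputable def transport (n : ℕ) (a : ℂ) (h : ℂ → ℂ) (w : ℂ) : ℂ :=
  transportWeight n a w * h (mobius a w)

section transport

variable {n : ℕ} {a w : ℂ}

theorem conj_one_sub_conj_mul (a w : ℂ) : conj (1 - conj a * w) = 1 - a * conj w := by
  simp

/-- Numerator and denominator have conjugate bases, so only the difference 2 of the exponents
survives in modulus. Up to the factor 1-|a|², this is the square root of the Jacobian, whence the
multiple of a unitary operator. -/
theorem norm_transportWeight (hn : 1 ≤ n) (ha : a ∈ unitDisk) (hw : w ∈ unitDisk) :
    ‖transportWeight n a w‖ = (‖1 - conj a * w‖ ^ 2)⁻¹ := by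
  have hne := norm_ne_zero_iff.2 (one_sub_conj_mul_ne_zero ha hw)
  rw [transportWeight, norm_div, norm_pow, norm_pow, ← conj_one_sub_conj_mul, Complex.norm_conj]
  obtain ⟨m, rfl⟩ := Nat.exists_eq_add_of_le' hn
  rw [Nat.add_sub_cancel, add_assoc, pow_add]
  field_simp

theorem transportWeight_mobius (hn : 1 ≤ n) (ha : a ∈ unitDisk) (hw : w ∈ unitDisk) :
    transportWeight n a w * transportWeight n a (mobius a w) = ((1 - (‖a‖ : ℂ) ^ 2) ^ 2)⁻¹ := by
  have hne := one_sub_conj_mul_ne_zero ha hw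
  have hne' : 1 - a * conj w ≠ 0 := by
    rw [← conj_one_sub_conj_mul]
    exact (map_ne_zero _).2 hne
  have h0 := one_sub_sq_ne_zero ha
  have h1 := one_sub_conj_mul_mobius ha hw
  have h2 : 1 - a * conj (mobius a w) = (1 - (‖a‖ : ℂ) ^ 2) / (1 - a * conj w) := by
    rw [← conj_one_sub_conj_mul, h1]
    simp
  rw [transportWeight, transportWeight, h1, h2]
  obtain ⟨m, rfl⟩ := Nat.exists_eq_add_of_le' hn
  rw [Nat.add_sub_cancel, add_assoc, pow_add, pow_add, div_pow, div_pow]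
  field_simp
  ring

theorem transport_transport (hn : 1 ≤ n) (ha : a ∈ unitDisk) (hw : w ∈ unitDisk) (h : ℂ → ℂ) :
    transport n a (transport n a h) w = ((1 - (‖a‖ : ℂ) ^ 2) ^ 2)⁻¹ * h w := by
  rw [transport, transport, mobius_mobius ha hw, ← mul_assoc, transportWeight_mobius hn ha hw]

theorem norm_transportWeight_sq (hn : 1 ≤ n) (ha : a ∈ unitDisk) (hw : w ∈ unitDisk) :
    ‖transportWeight n a w‖ ^ 2 = ((1 - ‖a‖ ^ 2) ^ 2)⁻¹ * mobiusJacobian a w := by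
  have hne := norm_ne_zero_iff.2 (one_sub_conj_mul_ne_zero ha hw)
  have := (one_sub_sq_pos ha).ne'
  rw [norm_transportWeight hn ha hw, mobiusJacobian]
  field_simp

theorem transport_mul_conj_transport (hn : 1 ≤ n) (ha : a ∈ unitDisk) (hw : w ∈ unitDisk)
    (g h : ℂ → ℂ) :
    transport n a h w * conj (transport n a g w) =
      ((1 - (‖a‖ : ℂ) ^ 2) ^ 2)⁻¹ *
        mobiusJacobian a w • (h (mobius a w) * conj (g (mobius a w))) := by
  have h1 : transportWeight n a w * conj (transportWeight n a w) =
      ((1 - (‖a‖ : ℂ) ^ 2) ^ 2)⁻¹ * mobiusJacobian a w := by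
    rw [Complex.mul_conj', ← Complex.ofReal_pow, norm_transportWeight_sq hn ha hw]
    push_cast
    ring
  simp only [transport, map_mul, Complex.real_smul]
  linear_combination (h (mobius a w) * conj (g (mobius a w))) * h1

theorem integral_transport_mul_conj (hn : 1 ≤ n) (ha : a ∈ unitDisk) (g h : ℂ → ℂ) :
    ∫ w, transport n a h w * conj (transport n a g w) ∂area =
      ((1 - (‖a‖ : ℂ) ^ 2) ^ 2)⁻¹ * ∫ w, h w * conj (g w) ∂area := by
  rw [integral_mobius ha fun w => h w * conj (g w), ← integral_const_mul]
  refine integral_congr_ae ?_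
  filter_upwards [ae_mem_unitDisk] with w hw
  exact transport_mul_conj_transport hn ha hw g h

/-- The conjugate of φ_a(w) has the antiholomorphic denominator 1 - a w̄. The n-1 such factors in
the weight absorb its j-th power for every j ≤ n-1, leaving a polynomial of degree (n-1-j) + j = n-1
in w̄. This dictates the exponent n-1 in `transportWeight`. -/
theorem IsConjPolynomial.transport (hn : 1 ≤ n) (ha : a ∈ unitDisk) {h : ℂ → ℂ}
    (hh : IsConjPolynomial n h) : IsConjPolynomial n (transport n a h) := by
  obtain ⟨F, hF, he⟩ := hh
  have hφ : DifferentiableOn ℂ (mobius a) unitDisk := fun w hw =>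
    (hasDerivAt_mobius ha hw).differentiableAt.differentiableWithinAt
  have hd : DifferentiableOn ℂ (fun w => ((1 - conj a * w) ^ (n + 1))⁻¹) unitDisk :=
    DifferentiableOn.inv (by fun_prop) fun w hw => pow_ne_zero _ (one_sub_conj_mul_ne_zero ha hw)
  have key : ∀ j ∈ Finset.range n, IsConjPolynomial n fun w =>
      (1 + -a * conj w) ^ (n - 1 - j) * ((conj a + -1 * conj w) ^ j *
        (((1 - conj a * w) ^ (n + 1))⁻¹ * F j (mobius a w))) := by
    intro j hj
    have h1 : IsConjPolynomial 1 fun w => ((1 - conj a * w) ^ (n + 1))⁻¹ * F j (mobius a w) :=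
      .of_differentiableOn (hd.mul ((hF j).comp hφ fun w hw => mobius_mem ha hw))
    have := (h1.linear_conj_pow_mul (conj a) (-1) j).linear_conj_pow_mul 1 (-a) (n - 1 - j)
    have hj' := Finset.mem_range.1 hj
    rwa [show 1 + j + (n - 1 - j) = n by lia] at this
  refine (IsConjPolynomial.sum _ key).congr fun w hw => ?_
  simp only [PolyBergman.transport, he _ (mobius_mem ha hw), Finset.mul_sum]
  refine Finset.sum_congr rfl fun j hj => ?_
  have hj' := Finset.mem_range.1 hj
  have hne := one_sub_conj_mul_ne_zero ha hw
  have hne' : 1 - a * conj w ≠ 0 := by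
    rw [← conj_one_sub_conj_mul]
    exact (map_ne_zero _).2 hne
  have hsplit : (1 - a * conj w) ^ (n - 1) =
      (1 - a * conj w) ^ (n - 1 - j) * (1 - a * conj w) ^ j := by
    rw [← pow_add, Nat.sub_add_cancel (by lia)]
  have hm : conj (mobius a w) = (conj a + -1 * conj w) / (1 - a * conj w) := by
    simp [mobius, sub_eq_add_neg]
  rw [transportWeight, hsplit, hm, div_pow]
  have : 1 + -a * conj w = 1 - a * conj w := by ring
  rw [this]
  field_simp

theorem lintegral_transport (hn : 1 ≤ n) (ha : a ∈ unitDisk) (h : ℂ → ℂ) :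
    ∫⁻ w, ‖transport n a h w‖ₑ ^ 2 ∂area =
      ENNReal.ofReal ((1 - ‖a‖ ^ 2) ^ 2)⁻¹ * ∫⁻ w, ‖h w‖ₑ ^ 2 ∂area := by
  rw [lintegral_mobius ha fun w => ‖h w‖ₑ ^ 2, ← lintegral_const_mul' _ _ ENNReal.ofReal_ne_top]
  refine lintegral_congr_ae ?_
  filter_upwards [ae_mem_unitDisk] with w hw
  rw [transport, enorm_mul, mul_pow, ← mul_assoc, ← ENNReal.ofReal_mul (by positivity),
    ← norm_transportWeight_sq hn ha hw, ← ofReal_norm,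
    ENNReal.ofReal_pow (norm_nonneg _)]

end transport

/-! ### The reproducing kernel in closed form. -/

theorem memLp_two_area_iff {h : ℂ → ℂ} (hh : ContinuousOn h unitDisk) :
    MemLp h 2 area ↔ ∫⁻ w, ‖h w‖ₑ ^ 2 ∂area < ∞ := by
  have h2 := eLpNorm_lt_top_iff_lintegral_rpow_enorm_lt_top (f := h) (μ := area)
    two_ne_zero ENNReal.ofNat_ne_top
  simp only [ENNReal.toReal_ofNat, ENNReal.rpow_ofNat] at h2
  rw [MemLp, h2, and_iff_right (aestronglyMeasurable_area hh)]

theorem mem_bergmanFun_iff {n : ℕ} {h : ℂ → ℂ} :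
    h ∈ bergmanFun n ↔ IsConjPolynomial n h ∧ MemLp h 2 area := by
  rw [← isPolyanalytic_iff_isConjPolynomial]
  rfl

theorem IsConjPolynomial.memLp_of_bounded {n : ℕ} {h : ℂ → ℂ} (hh : IsConjPolynomial n h) {C : ℝ}
    (hC : ∀ w ∈ unitDisk, ‖h w‖ ≤ C) : MemLp h 2 area :=
  MemLp.of_bound (aestronglyMeasurable_area hh.continuousOn) C
    (ae_mem_unitDisk.mono fun w hw => hC w hw)

theorem transport_mem {n : ℕ} (hn : 1 ≤ n) {a : ℂ} (ha : a ∈ unitDisk) {h : ℂ → ℂ}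
    (hh : h ∈ bergmanFun n) : transport n a h ∈ bergmanFun n := by
  rw [mem_bergmanFun_iff] at hh ⊢
  have h1 := hh.1.transport hn ha
  refine ⟨h1, (memLp_two_area_iff h1.continuousOn).2 ?_⟩
  rw [lintegral_transport hn ha]
  exact ENNReal.mul_lt_top ENNReal.ofReal_lt_top
    ((memLp_two_area_iff hh.1.continuousOn).1 hh.2)

/-- The reproducing kernel function of `A²_n` at the origin. -/
noncomputable def centralKernel (n : ℕ) (w : ℂ) : ℂ :=
  ((momentPolynomial n).eval (‖w‖ ^ 2) : ℝ)

/-- The reproducing kernel function of `A²_n`, in closed form. -/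
noncomputable def explicitKernel (n : ℕ) (a : ℂ) : ℂ → ℂ := transport n a (centralKernel n)

theorem continuous_centralKernel (n : ℕ) : Continuous (centralKernel n) := by
  unfold centralKernel
  have := (momentPolynomial n).continuous
  fun_prop

theorem exists_bound_centralKernel (n : ℕ) :
    ∃ C : ℝ, 0 ≤ C ∧ ∀ w ∈ unitDisk, ‖centralKernel n w‖ ≤ C := by
  obtain ⟨C, hC⟩ := (isCompact_closedBall (0 : ℂ) 1).exists_bound_of_continuousOn
    (continuous_centralKernel n).continuousOn
  exact ⟨C, (norm_nonneg _).trans (hC 0 (by simp)),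
    fun w hw => hC w (Metric.ball_subset_closedBall hw)⟩

theorem centralKernel_eq_sum (n : ℕ) (w : ℂ) : centralKernel n w =
    ∑ k ∈ Finset.range n, conj w ^ k * (((momentPolynomial n).coeff k : ℂ) * w ^ k) := by
  rw [centralKernel, eval_eq_sum_range_of_mem_degreeLT (momentPolynomial_mem n)]
  push_cast
  refine Finset.sum_congr rfl fun k _ => ?_
  rw [← Complex.conj_mul', mul_pow]
  ring

theorem isConjPolynomial_centralKernel (n : ℕ) : IsConjPolynomial n (centralKernel n) :=
  ⟨fun k w => ((momentPolynomial n).coeff k : ℂ) * w ^ k, fun k => by fun_prop,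
    fun w _ => centralKernel_eq_sum n w⟩

theorem centralKernel_mem (n : ℕ) : centralKernel n ∈ bergmanFun n := by
  obtain ⟨C, -, hC⟩ := exists_bound_centralKernel n
  exact mem_bergmanFun_iff.2 ⟨isConjPolynomial_centralKernel n,
    (isConjPolynomial_centralKernel n).memLp_of_bounded hC⟩

theorem explicitKernel_mem {n : ℕ} (hn : 1 ≤ n) {a : ℂ} (ha : a ∈ unitDisk) :
    explicitKernel n a ∈ bergmanFun n :=
  transport_mem hn ha (centralKernel_mem n)

/-- The mean value property with r = 1; the factor π cancels against the normalization of the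
measure. -/
theorem integral_mul_conj_centralKernel {n : ℕ} (hn : 1 ≤ n) {h : ℂ → ℂ}
    (hh : h ∈ bergmanFun n) : ∫ w, h w * conj (centralKernel n w) ∂area = h 0 := by
  rw [mem_bergmanFun_iff] at hh
  have hi : Integrable h area := hh.2.integrable (by norm_num)
  have := hh.1.setIntegral_mul_momentPolynomial hn one_pos le_rfl (integrable_area_iff.1 hi)
  have hpi : (Real.pi : ℂ) ≠ 0 := by exact_mod_cast Real.pi_ne_zero
  rw [integral_area]
  simp only [centralKernel, Complex.conj_ofReal]
  simp only [one_pow, div_one] at this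
  rw [unitDisk, this, Complex.real_smul]
  push_cast
  field_simp

/-- Let U be `transport n a`. Since U² and the defect of U from being unitary are the same scalar,
⟨h, U K_0⟩ = ⟨U h, K_0⟩ = (U h)(0), and the weight equals 1 at w = 0, so this is h(a). -/
theorem isReproducingAt_explicitKernel {n : ℕ} (hn : 1 ≤ n) {a : ℂ} (ha : a ∈ unitDisk) :
    IsReproducingAt n a (explicitKernel n a) := by
  refine ⟨explicitKernel_mem hn ha, fun h hh => ?_⟩
  have h0 := one_sub_sq_ne_zero ha
  have h1 := integral_mul_conj_centralKernel hn (transport_mem hn ha hh)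
  have h2 : ∫ w, h w * conj (explicitKernel n a w) ∂area = (1 - (‖a‖ : ℂ) ^ 2) ^ 2 *
      ∫ w, transport n a (transport n a h) w * conj (explicitKernel n a w) ∂area := by
    rw [← integral_const_mul]
    refine integral_congr_ae ?_
    filter_upwards [ae_mem_unitDisk] with w hw
    rw [transport_transport hn ha hw]
    field_simp
  rw [h2, explicitKernel, integral_transport_mul_conj hn ha, h1]
  simp [transport, transportWeight]
  field_simp

theorem isReproducingAt_kernel {n : ℕ} (hn : 1 ≤ n) {a : ℂ} (ha : a ∈ unitDisk) :
    IsReproducingAt n a (kernel n a) := by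
  have h : ∃ g, IsReproducingAt n a g := ⟨_, isReproducingAt_explicitKernel hn ha⟩
  rw [kernel, dif_pos h]
  exact h.choose_spec

/-- Both functions have the same inner product with the explicit kernel at w, and that inner product
determines their values at w. -/
theorem kernel_eq_explicitKernel {n : ℕ} (hn : 1 ≤ n) {a : ℂ} (ha : a ∈ unitDisk) :
    Set.EqOn (kernel n a) (explicitKernel n a) unitDisk := by
  intro w hw
  have hk := isReproducingAt_kernel hn ha
  have he := isReproducingAt_explicitKernel hn ha
  have hw' := isReproducingAt_explicitKernel hn hw
  have h1 := (hk.2 _ hw'.1).symm.trans (he.2 _ hw'.1)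
  have h2 := congrArg conj (hw'.2 _ hk.1)
  have h3 := congrArg conj (hw'.2 _ he.1)
  rw [← integral_conj] at h2 h3
  simp only [map_mul, Complex.conj_conj, mul_comm] at h1 h2 h3
  exact (starRingEnd ℂ).injective (h2.trans (h1.trans h3.symm))

/-! ### The projection onto the Bergman space and its closedness. -/

theorem hasDerivAt_inv_one_sub_conj_mul_pow {w z : ℂ} (hw : w ∈ unitDisk) (hz : z ∈ unitDisk)
    (m : ℕ) : HasDerivAt (fun z => ((1 - conj w * z) ^ m)⁻¹)
      (m * conj w * ((1 - conj w * z) ^ (m + 1))⁻¹) z := by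
  have hne := one_sub_conj_mul_ne_zero hw hz
  have h2 : HasDerivAt (fun z => 1 - conj w * z) (-conj w) z := by
    simpa using ((hasDerivAt_id z).const_mul (conj w)).const_sub 1
  refine ((h2.fun_pow m).fun_inv (pow_ne_zero m hne)).congr_deriv ?_
  rcases m with _ | m
  · simp
  · simp only [Nat.add_sub_cancel]
    field_simp
    ring

theorem norm_inv_one_sub_conj_mul_pow_le {w z : ℂ} (hw : w ∈ unitDisk) {R : ℝ} (hR : R < 1)
    (hz : ‖z‖ ≤ R) (m : ℕ) : ‖((1 - conj w * z) ^ m)⁻¹‖ ≤ ((1 - R) ^ m)⁻¹ := by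
  have h1 := one_sub_norm_le (a := z) hw
  have h2 : ‖1 - conj w * z‖ = ‖1 - conj z * w‖ := by
    rw [← Complex.norm_conj]
    simp [mul_comm]
  rw [norm_inv, norm_pow, h2]
  exact inv_anti₀ (pow_pos (by linarith) m) (pow_le_pow_left₀ (by linarith) (by linarith) m)

theorem continuousOn_inv_one_sub_conj_mul_pow {z : ℂ} (hz : z ∈ unitDisk) (m : ℕ) :
    ContinuousOn (fun w => ((1 - conj w * z) ^ m)⁻¹) unitDisk :=
  ContinuousOn.inv₀ (by fun_prop) fun _ hw => pow_ne_zero m (one_sub_conj_mul_ne_zero hw hz)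

theorem integrable_mul_inv_one_sub_pow {g : ℂ → ℂ} (hg : Integrable g area) {z : ℂ}
    (hz : z ∈ unitDisk) (m : ℕ) :
    Integrable (fun w => g w * ((1 - conj w * z) ^ m)⁻¹) area := by
  refine hg.mul_bdd (c := ((1 - ‖z‖) ^ m)⁻¹)
    (aestronglyMeasurable_area (continuousOn_inv_one_sub_conj_mul_pow hz m)) ?_
  filter_upwards [ae_mem_unitDisk] with w hw
  exact norm_inv_one_sub_conj_mul_pow_le hw (mem_unitDisk.1 hz) le_rfl m

theorem differentiableOn_integral_inv_one_sub_pow {g : ℂ → ℂ} (hg : Integrable g area) (m : ℕ) :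
    DifferentiableOn ℂ (fun z => ∫ w, g w * ((1 - conj w * z) ^ m)⁻¹ ∂area) unitDisk := by
  intro z hz
  obtain ⟨R, hzR, hR⟩ := exists_between (mem_unitDisk.1 hz)
  have hball : ∀ {x : ℂ}, x ∈ Metric.ball 0 R → x ∈ unitDisk := fun hx =>
    Metric.ball_subset_ball hR.le hx
  have hconj : Integrable (fun w => g w * (m * conj w)) area := by
    refine hg.mul_bdd (c := m) (Continuous.aestronglyMeasurable (by fun_prop)) ?_
    filter_upwards [ae_mem_unitDisk] with w hw
    rw [norm_mul, Complex.norm_conj, Complex.norm_natCast]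
    exact mul_le_of_le_one_right (Nat.cast_nonneg m) (mem_unitDisk.1 hw).le
  have := hasDerivAt_integral_of_dominated_loc_of_deriv_le (μ := area) (𝕜 := ℂ)
    (F := fun z w => g w * ((1 - conj w * z) ^ m)⁻¹)
    (F' := fun z w => g w * (m * conj w) * ((1 - conj w * z) ^ (m + 1))⁻¹)
    (bound := fun w => ‖g w * (m * conj w)‖ * ((1 - R) ^ (m + 1))⁻¹)
    (Metric.isOpen_ball.mem_nhds (show z ∈ Metric.ball 0 R by simpa using hzR)) ?_
    (integrable_mul_inv_one_sub_pow hg hz m)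
    (integrable_mul_inv_one_sub_pow hconj hz (m + 1)).aestronglyMeasurable ?_
    (hconj.norm.mul_const _) ?_
  · exact this.2.differentiableAt.differentiableWithinAt
  · filter_upwards [isOpen_unitDisk.mem_nhds hz] with x hx
    exact (integrable_mul_inv_one_sub_pow hg hx m).aestronglyMeasurable
  · filter_upwards [ae_mem_unitDisk] with w hw x hx
    rw [norm_mul]
    refine mul_le_mul_of_nonneg_left ?_ (norm_nonneg _)
    exact norm_inv_one_sub_conj_mul_pow_le hw hR (mem_ball_zero_iff.1 hx).le _
  · filter_upwards [ae_mem_unitDisk] with w hw x hx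
    refine ((hasDerivAt_inv_one_sub_conj_mul_pow hw (hball hx) m).const_mul (g w)).congr_deriv ?_
    ring

/-- Integration against `Φ` maps integrable functions to polynomials of degree less than `n`
in `z̄` with holomorphic coefficients. -/
def IsConjPolynomialKernel (n : ℕ) (Φ : ℂ → ℂ → ℂ) : Prop :=
  ∀ g : ℂ → ℂ, Integrable g area →
    (∀ z ∈ unitDisk, Integrable (fun w => g w * Φ z w) area) ∧
      IsConjPolynomial n fun z => ∫ w, g w * Φ z w ∂area

namespace IsConjPolynomialKernel

variable {n : ℕ} {Φ Ψ : ℂ → ℂ → ℂ}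

theorem inv_one_sub_pow (m : ℕ) :
    IsConjPolynomialKernel 1 fun z w => ((1 - conj w * z) ^ m)⁻¹ := fun _ hg =>
  ⟨fun _ hz => integrable_mul_inv_one_sub_pow hg hz m,
    .of_differentiableOn (differentiableOn_integral_inv_one_sub_pow hg m)⟩

theorem congr (hΦ : IsConjPolynomialKernel n Φ)
    (e : ∀ z ∈ unitDisk, ∀ w ∈ unitDisk, Ψ z w = Φ z w) : IsConjPolynomialKernel n Ψ := by
  intro g hg
  have hae : ∀ z ∈ unitDisk, (fun w => g w * Φ z w) =ᵐ[area] fun w => g w * Ψ z w := by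
    intro z hz
    filter_upwards [ae_mem_unitDisk] with w hw
    rw [e z hz w hw]
  exact ⟨fun z hz => ((hΦ g hg).1 z hz).congr (hae z hz),
    (hΦ g hg).2.congr fun z hz => (integral_congr_ae (hae z hz)).symm⟩

theorem mul_right_fun (hΦ : IsConjPolynomialKernel n Φ) {ψ : ℂ → ℂ} (hψ : Continuous ψ) :
    IsConjPolynomialKernel n fun z w => ψ w * Φ z w := by
  intro g hg
  obtain ⟨C, hC⟩ := (isCompact_closedBall (0 : ℂ) 1).exists_bound_of_continuousOn hψ.continuousOn
  have hg' : Integrable (fun w => g w * ψ w) area := by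
    refine hg.mul_bdd (c := C) hψ.aestronglyMeasurable ?_
    filter_upwards [ae_mem_unitDisk] with w hw
    exact hC w (Metric.ball_subset_closedBall hw)
  simpa only [mul_assoc] using hΦ _ hg'

theorem mul_left_fun (hΦ : IsConjPolynomialKernel n Φ) {p : ℂ → ℂ}
    (hp : DifferentiableOn ℂ p unitDisk) : IsConjPolynomialKernel n fun z w => p z * Φ z w := by
  intro g hg
  simp only [mul_left_comm (g _), integral_const_mul]
  exact ⟨fun z hz => ((hΦ g hg).1 z hz).const_mul _, (hΦ g hg).2.mul_differentiableOn hp⟩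

theorem conj_mul (hΦ : IsConjPolynomialKernel n Φ) :
    IsConjPolynomialKernel (n + 1) fun z w => conj z * Φ z w := by
  intro g hg
  simp only [mul_left_comm (g _), integral_const_mul]
  exact ⟨fun z hz => ((hΦ g hg).1 z hz).const_mul _, (hΦ g hg).2.conj_mul⟩

theorem succ (hΦ : IsConjPolynomialKernel n Φ) : IsConjPolynomialKernel (n + 1) Φ := fun g hg =>
  ⟨(hΦ g hg).1, (hΦ g hg).2.succ⟩

theorem add (hΦ : IsConjPolynomialKernel n Φ) (hΨ : IsConjPolynomialKernel n Ψ) :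
    IsConjPolynomialKernel n fun z w => Φ z w + Ψ z w := by
  intro g hg
  simp only [mul_add]
  refine ⟨fun z hz => ((hΦ g hg).1 z hz).add ((hΨ g hg).1 z hz), ?_⟩
  exact ((hΦ g hg).2.add (hΨ g hg).2).congr fun z hz =>
    integral_add ((hΦ g hg).1 z hz) ((hΨ g hg).1 z hz)

theorem sum {ι : Type*} (s : Finset ι) {Φ : ι → ℂ → ℂ → ℂ}
    (hΦ : ∀ i ∈ s, IsConjPolynomialKernel n (Φ i)) :
    IsConjPolynomialKernel n fun z w => ∑ i ∈ s, Φ i z w := by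
  classical
  induction s using Finset.induction_on with
  | empty => exact fun g _ => ⟨fun z _ => by simp, by simpa using! IsConjPolynomial.zero n⟩
  | insert i s hi ih =>
    simp only [Finset.sum_insert hi]
    exact (hΦ i (Finset.mem_insert_self i s)).add
      (ih fun j hj => hΦ j (Finset.mem_insert_of_mem hj))

theorem linear_conj_pow_mul (hΦ : IsConjPolynomialKernel n Φ) {a b : ℂ → ℂ} (ha : Continuous a)
    (hb : Continuous b) (k : ℕ) :
    IsConjPolynomialKernel (n + k) fun z w => (a w + b w * conj z) ^ k * Φ z w := by
  induction k with
  | zero => simpa using hΦ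
  | succ k ih =>
    refine ((ih.mul_right_fun ha).succ.add (ih.mul_right_fun hb).conj_mul).congr
      fun z _ w _ => ?_
    ring

theorem linear_pow_mul (hΦ : IsConjPolynomialKernel n Φ) {a b : ℂ → ℂ} (ha : Continuous a)
    (hb : Continuous b) (k : ℕ) :
    IsConjPolynomialKernel n fun z w => (a w + b w * z) ^ k * Φ z w := by
  induction k with
  | zero => simpa using hΦ
  | succ k ih =>
    refine ((ih.mul_right_fun ha).add
      ((ih.mul_right_fun hb).mul_left_fun differentiableOn_id)).congr fun z _ w _ => ?_
    simp only [id]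
    ring

end IsConjPolynomialKernel

/-- Expand q in powers of |φ_z(w)|². In the k-th term the denominators in z̄ cancel against the
weight, leaving n-1-k and k linear factors in z̄. The rest is holomorphic in z with denominator (1 -
w̄z)^(n+1+k), whose integrals can be differentiated under the integral sign. -/
theorem isConjPolynomialKernel_explicitKernel {n : ℕ} (hn : 1 ≤ n) :
    IsConjPolynomialKernel n fun z w => conj (explicitKernel n z w) := by
  have key : ∀ k ∈ Finset.range n, IsConjPolynomialKernel n fun z w =>
      ((momentPolynomial n).coeff k : ℂ) * ((1 + -w * conj z) ^ (n - 1 - k) *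
        ((conj w + -1 * conj z) ^ k * ((w + -1 * z) ^ k *
          ((1 - conj w * z) ^ (n + 1 + k))⁻¹))) := by
    intro k hk
    have hk' := Finset.mem_range.1 hk
    have h1 := (((IsConjPolynomialKernel.inv_one_sub_pow (n + 1 + k)).linear_pow_mul
      continuous_id (b := fun _ => -1) continuous_const k).linear_conj_pow_mul
      Complex.continuous_conj (b := fun _ => -1) continuous_const k).linear_conj_pow_mul
      (a := fun _ => 1) (b := fun w => -w) continuous_const continuous_neg (n - 1 - k)
    rw [show 1 + k + (n - 1 - k) = n by lia] at h1
    exact h1.mul_left_fun (differentiableOn_const ((momentPolynomial n).coeff k : ℂ))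
  refine (IsConjPolynomialKernel.sum _ key).congr fun z hz w hw => ?_
  have hne := one_sub_conj_mul_ne_zero hw hz
  have hne' : 1 - w * conj z ≠ 0 := by
    rw [← conj_one_sub_conj_mul]
    exact (map_ne_zero _).2 hne
  rw [explicitKernel, transport, centralKernel_eq_sum, map_mul, map_sum, Finset.mul_sum]
  refine Finset.sum_congr rfl fun k hk => ?_
  have hk' := Finset.mem_range.1 hk
  have hsplit : (1 - w * conj z) ^ (n - 1) =
      (1 - w * conj z) ^ (n - 1 - k) * (1 - w * conj z) ^ k := by
    rw [← pow_add, Nat.sub_add_cancel (by lia)]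
  have e1 : 1 + -w * conj z = 1 - w * conj z := by ring
  have e2 : 1 - conj z * w = 1 - w * conj z := by ring
  have e3 : 1 - z * conj w = 1 - conj w * z := by ring
  simp only [transportWeight, mobius, map_mul, map_div₀, map_pow, map_sub, map_one,
    Complex.conj_conj, Complex.conj_ofReal, e1, e2, e3, hsplit, div_pow, pow_add]
  have e4 : conj w + -1 * conj z = -(conj z - conj w) := by ring
  have e5 : w + -1 * z = -(z - w) := by ring
  have e6 : (-(conj z - conj w)) ^ k * (-(z - w)) ^ k = (conj z - conj w) ^ k * (z - w) ^ k := by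
    rw [← mul_pow, ← mul_pow, neg_mul_neg]
  rw [e4, e5, ← mul_assoc ((-(conj z - conj w)) ^ k), e6]
  field_simp

/-- The function `z ↦ ⟨g, K_z⟩`, the orthogonal projection of `g` to `A²_n`. -/
noncomputable def projection (n : ℕ) (g : ℂ → ℂ) (z : ℂ) : ℂ :=
  ∫ w, g w * conj (explicitKernel n z w) ∂area

theorem isConjPolynomial_projection {n : ℕ} (hn : 1 ≤ n) {g : ℂ → ℂ} (hg : Integrable g area) :
    IsConjPolynomial n (projection n g) :=
  (isConjPolynomialKernel_explicitKernel hn g hg).2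

theorem inner_lp_eq_integral (x y : Lp ℂ 2 area) :
    inner ℂ x y = ∫ w, y w * conj (x w) ∂area := by
  rw [L2.inner_def]
  exact integral_congr_ae (ae_of_all _ fun w => RCLike.inner_apply _ _)

theorem inner_toLp {g : ℂ → ℂ} (hg : MemLp g 2 area) (x : Lp ℂ 2 area) :
    inner ℂ (hg.toLp g) x = ∫ w, x w * conj (g w) ∂area := by
  rw [inner_lp_eq_integral]
  refine integral_congr_ae ?_
  filter_upwards [hg.coeFn_toLp] with w hw
  rw [hw]

/-- If h_k → y in L², then h_k(z) = ⟨h_k, K_z⟩ converges at every point to the projection of y,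
while a subsequence converges to y almost everywhere. So y agrees almost everywhere with its
projection, which is n-analytic. -/
theorem isClosed_bergmanSpace {n : ℕ} (hn : 1 ≤ n) :
    IsClosed (bergmanSpace n : Set (Lp ℂ 2 area)) := by
  refine IsSeqClosed.isClosed fun x y hx hxy => ?_
  choose h hh using hx
  have hhx : ∀ k, x k =ᵐ[area] (h k).1 := fun k => by
    rw [← hh k]
    exact (h k).2.2.coeFn_toLp
  have hev : ∀ z ∈ unitDisk,
      Tendsto (fun k => (h k).1 z) atTop (𝓝 (projection n y z)) := by
    intro z hz
    have hK := isReproducingAt_explicitKernel hn hz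
    have h1 : ∀ k, (h k).1 z = inner ℂ (hK.1.2.toLp (explicitKernel n z)) (x k) := by
      intro k
      rw [inner_toLp, hK.2 _ (h k).2]
      refine integral_congr_ae ?_
      filter_upwards [hhx k] with w hw
      rw [hw]
    simp_rw [h1]
    rw [projection, ← inner_toLp hK.1.2]
    exact tendsto_const_nhds.inner hxy
  obtain ⟨ns, hns, hae⟩ := (tendstoInMeasure_of_tendsto_Lp hxy).exists_seq_tendsto_ae
  have hyP : y =ᵐ[area] projection n y := by
    filter_upwards [hae, ae_mem_unitDisk, ae_all_iff.2 fun k => hhx (ns k)] with w hw hwD hk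
    have hsub : Tendsto (fun k => x (ns k) w) atTop (𝓝 (projection n y w)) := by
      simp_rw [hk]
      exact (hev w hwD).comp hns.tendsto_atTop
    exact tendsto_nhds_unique hw hsub
  have hmem : projection n y ∈ bergmanFun n :=
    mem_bergmanFun_iff.2 ⟨isConjPolynomial_projection hn ((Lp.memLp y).integrable (by norm_num)),
      (memLp_congr_ae hyP).1 (Lp.memLp y)⟩
  refine ⟨⟨_, hmem⟩, Lp.ext ?_⟩
  exact (MemLp.coeFn_toLp hmem.2).trans hyP.symm

theorem completeSpace_bergmanSpace {n : ℕ} (hn : 1 ≤ n) : CompleteSpace (bergmanSpace n) :=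
  (isClosed_bergmanSpace hn).completeSpace_coe

theorem toBergman_surjective (n : ℕ) : Function.Surjective (toBergman n) :=
  (toL2 n).surjective_rangeRestrict

noncomputable instance instInnerBergmanSpace (n : ℕ) : Inner ℂ (bergmanSpace n) :=
  InnerProductSpace.toInner

theorem inner_toBergman {n : ℕ} (g h : bergmanFun n) :
    inner ℂ (toBergman n g) (toBergman n h) = ∫ w, h.1 w * conj (g.1 w) ∂area := by
  have : inner ℂ (toBergman n g) (toBergman n h) =
      inner ℂ (g.2.2.toLp g.1) (h.2.2.toLp h.1) := rfl
  rw [this, inner_toLp]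
  refine integral_congr_ae ?_
  filter_upwards [h.2.2.coeFn_toLp] with w hw
  rw [hw]

theorem enorm_toBergman_sq {n : ℕ} (h : bergmanFun n) :
    ‖toBergman n h‖ₑ ^ 2 = ∫⁻ w, ‖h.1 w‖ₑ ^ 2 ∂area := by
  have h1 : ‖toBergman n h‖ₑ = ‖h.2.2.toLp h.1‖ₑ := rfl
  rw [h1, Lp.enorm_toLp, eLpNorm_eq_lintegral_rpow_enorm_toReal two_ne_zero ENNReal.ofNat_ne_top]
  simp only [ENNReal.toReal_ofNat, ENNReal.rpow_ofNat, one_div]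
  rw [← ENNReal.rpow_natCast, ← ENNReal.rpow_mul]
  simp

/-! ### Kernel vectors in the Hilbert space. -/

/-- The kernel function `K_z`, as a vector of `A²_n`. -/
noncomputable def kernelVector (n : ℕ) (z : ℂ) : bergmanSpace n :=
  toBergman n ⟨kernel n z, kernel_mem n z⟩

theorem inner_kernelVector {n : ℕ} (hn : 1 ≤ n) {z : ℂ} (hz : z ∈ unitDisk) (h : bergmanFun n) :
    inner ℂ (kernelVector n z) (toBergman n h) = h.1 z := by
  rw [kernelVector, inner_toBergman]
  exact ((isReproducingAt_kernel hn hz).2 _ h.2).symm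

theorem inner_kernelVector_kernelVector {n : ℕ} (hn : 1 ≤ n) {z w : ℂ} (hz : z ∈ unitDisk)
    (hw : w ∈ unitDisk) :
    inner ℂ (kernelVector n z) (kernelVector n w) = explicitKernel n w z := by
  rw [kernelVector.eq_1 n w, inner_kernelVector hn hz]
  exact kernel_eq_explicitKernel hn hw hz

theorem explicitKernel_self {n : ℕ} (hn : 1 ≤ n) {z : ℂ} (hz : z ∈ unitDisk) :
    explicitKernel n z z = ((momentPolynomial n).eval 0 / (1 - ‖z‖ ^ 2) ^ 2 : ℝ) := by
  have h0 := one_sub_sq_ne_zero hz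
  obtain ⟨m, rfl⟩ := Nat.exists_eq_add_of_le' hn
  rw [explicitKernel, transport, transportWeight, mobius_self, Complex.mul_conj',
    Complex.conj_mul', centralKernel, Nat.add_sub_cancel, add_assoc, pow_add]
  simp only [norm_zero, ne_eq, OfNat.ofNat_ne_zero, not_false_eq_true, zero_pow]
  push_cast
  field_simp

theorem norm_kernelVector_sq {n : ℕ} (hn : 1 ≤ n) {z : ℂ} (hz : z ∈ unitDisk) :
    ‖kernelVector n z‖ ^ 2 = (momentPolynomial n).eval 0 / (1 - ‖z‖ ^ 2) ^ 2 := by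
  have h := inner_kernelVector_kernelVector hn hz hz
  rw [explicitKernel_self hn hz] at h
  refine (norm_sq_eq_re_inner (𝕜 := ℂ) (kernelVector n z)).trans ?_
  rw [h]
  exact Complex.ofReal_re _

theorem continuousOn_explicitKernel (n : ℕ) :
    ContinuousOn (fun p : ℂ × ℂ => explicitKernel n p.1 p.2) (unitDisk ×ˢ unitDisk) := by
  have hne : ∀ p ∈ unitDisk ×ˢ unitDisk, 1 - conj p.1 * p.2 ≠ 0 := fun p hp =>
    one_sub_conj_mul_ne_zero hp.1 hp.2
  have h1 : ContinuousOn (fun p : ℂ × ℂ => transportWeight n p.1 p.2) (unitDisk ×ˢ unitDisk) :=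
    ContinuousOn.div (by fun_prop) (by fun_prop) fun p hp => pow_ne_zero _ (hne p hp)
  have h2 : ContinuousOn (fun p : ℂ × ℂ => mobius p.1 p.2) (unitDisk ×ˢ unitDisk) :=
    ContinuousOn.div (by fun_prop) (by fun_prop) hne
  exact h1.mul ((continuous_centralKernel n).comp_continuousOn h2)

/-- Expanding ‖K_w - K_z‖² expresses it through values of the kernel, which is jointly continuous.
Norm continuity gives the measurability and local boundedness required to integrate rank one
operators. -/
theorem continuousOn_kernelVector {n : ℕ} (hn : 1 ≤ n) :
    ContinuousOn (kernelVector n) unitDisk := by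
  intro z hz
  have hz' := isOpen_unitDisk.mem_nhds hz
  have hcont : ∀ {u v : ℂ → ℂ}, ContinuousAt u z → ContinuousAt v z → u z = z → v z = z →
      Tendsto (fun w => (explicitKernel n (u w) (v w)).re) (𝓝 z)
        (𝓝 (explicitKernel n z z).re) := by
    intro u v hu hv huz hvz
    have h1 : ContinuousAt (fun p : ℂ × ℂ => explicitKernel n p.1 p.2) (u z, v z) :=
      (continuousOn_explicitKernel n).continuousAt
        ((isOpen_unitDisk.prod isOpen_unitDisk).mem_nhds (by simp [huz, hvz, hz]))
    have h2 := h1.comp (f := fun w => (u w, v w)) (hu.prodMk hv)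
    have h3 : Tendsto _ _ _ := Complex.continuous_re.continuousAt.comp h2
    simpa [Function.comp_def, huz, hvz] using h3
  refine ContinuousAt.continuousWithinAt ?_
  rw [ContinuousAt, tendsto_iff_norm_sub_tendsto_zero]
  have hsq : Tendsto (fun w => ‖kernelVector n w - kernelVector n z‖ ^ 2) (𝓝 z) (𝓝 0) := by
    have hlim := ((hcont continuousAt_id continuousAt_id rfl rfl).sub
      ((hcont (v := id) (u := fun _ => z) continuousAt_const continuousAt_id rfl rfl).const_mul
        2)).add (hcont (u := fun _ => z) (v := fun _ => z) continuousAt_const continuousAt_const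
          rfl rfl)
    have h0 : (explicitKernel n z z).re - 2 * (explicitKernel n z z).re +
      (explicitKernel n z z).re = 0 := by ring
    rw [h0] at hlim
    refine hlim.congr' ?_
    filter_upwards [hz'] with w hw
    have hself : ∀ {v : ℂ}, v ∈ unitDisk →
        ‖kernelVector n v‖ ^ 2 = (explicitKernel n v v).re := by
      intro v hv
      rw [← inner_kernelVector_kernelVector hn hv hv]
      exact norm_sq_eq_re_inner (𝕜 := ℂ) (kernelVector n v)
    rw [norm_sub_sq (𝕜 := ℂ), hself hw, hself hz, inner_kernelVector_kernelVector hn hw hz]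
    rfl
  have := hsq.sqrt
  simpa [Real.sqrt_sq (norm_nonneg _)] using this

/-! ### Boundary limits, sub-mean value inequalities and the Carleson estimate. -/

/-- The filter of `|z| ↑ 1`. -/
noncomputable abbrev toBoundary : Filter ℂ := comap (fun z : ℂ => ‖z‖) (𝓝[<] 1)

theorem tendsto_norm_toBoundary : Tendsto (fun z : ℂ => ‖z‖) toBoundary (𝓝 1) :=
  tendsto_comap.mono_right nhdsWithin_le_nhds

theorem eventually_mem_unitDisk : ∀ᶠ z in toBoundary, z ∈ unitDisk := by
  have : ∀ᶠ t in 𝓝[<] (1 : ℝ), t < 1 := eventually_mem_nhdsWithin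
  exact (tendsto_comap.eventually this).mono fun z hz => mem_unitDisk.2 hz

theorem exists_of_eventually_toBoundary {p : ℂ → Prop} (h : ∀ᶠ z in toBoundary, p z) :
    ∃ s < 1, ∀ z ∈ unitDisk, s < ‖z‖ → p z := by
  obtain ⟨s, hs, hsub⟩ := (mem_nhdsLT_iff_exists_Ioo_subset (a := (1 : ℝ))).1 (eventually_comap.1 h)
  exact ⟨s, hs, fun z hz hsz => hsub ⟨hsz, mem_unitDisk.1 hz⟩ z rfl⟩

theorem lintegral_sq_le_measure_mul {α : Type*} [MeasurableSpace α] {μ : Measure α}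
    {g : α → ℝ≥0∞} (hg : AEMeasurable g μ) :
    (∫⁻ x, g x ∂μ) ^ 2 ≤ μ Set.univ * ∫⁻ x, g x ^ 2 ∂μ := by
  have h := ENNReal.lintegral_mul_le_Lp_mul_Lq μ Real.HolderConjugate.two_two hg
    (aemeasurable_const (b := (1 : ℝ≥0∞)))
  simp only [Pi.mul_apply, mul_one, lintegral_const, ENNReal.rpow_ofNat, one_pow, one_mul] at h
  calc (∫⁻ x, g x ∂μ) ^ 2
      ≤ ((∫⁻ x, g x ^ 2 ∂μ) ^ (1 / 2 : ℝ) * μ Set.univ ^ (1 / 2 : ℝ)) ^ 2 := by gcongr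
    _ = μ Set.univ * ∫⁻ x, g x ^ 2 ∂μ := by
      rw [mul_pow, ← ENNReal.rpow_natCast, ← ENNReal.rpow_natCast, ← ENNReal.rpow_mul,
        ← ENNReal.rpow_mul]
      norm_num
      rw [mul_comm]

theorem setLIntegral_ball_eq {r : ℝ} (hr1 : r ≤ 1) (g : ℂ → ℝ≥0∞) :
    ∫⁻ v in Metric.ball 0 r, g v =
      ENNReal.ofReal Real.pi * ∫⁻ v, (Metric.ball 0 r).indicator g v ∂area := by
  rw [lintegral_area, setLIntegral_indicator measurableSet_ball,
    Set.inter_eq_self_of_subset_left (show Metric.ball (0 : ℂ) r ⊆ unitDisk from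
      Metric.ball_subset_ball hr1), ← mul_assoc, ← ENNReal.ofReal_mul Real.pi_pos.le,
    mul_inv_cancel₀ Real.pi_ne_zero, ENNReal.ofReal_one, one_mul]

/-- The sub-mean value property at the origin. -/
theorem exists_enorm_apply_zero_sq_le {n : ℕ} (hn : 1 ≤ n) {r : ℝ} (hr : 0 < r) (hr1 : r ≤ 1) :
    ∃ C : ℝ≥0∞, C ≠ ∞ ∧ ∀ h ∈ bergmanFun n,
      ‖h 0‖ₑ ^ 2 ≤ C * ∫⁻ v, (Metric.ball 0 r).indicator (fun v => ‖h v‖ₑ ^ 2) v ∂area := by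
  have hQ : Continuous fun v : ℂ => (((momentPolynomial n).eval (‖v‖ ^ 2 / r ^ 2) : ℝ) : ℂ) := by
    have := (momentPolynomial n).continuous
    fun_prop
  obtain ⟨M, hM⟩ := (isCompact_closedBall (0 : ℂ) r).exists_bound_of_continuousOn hQ.continuousOn
  set c : ℝ≥0∞ := ‖(Real.pi * r ^ 2 : ℂ)‖ₑ⁻¹ * ENNReal.ofReal M with hc
  set V : ℝ≥0∞ := volume (Metric.ball (0 : ℂ) r)
  have hpi : (Real.pi * r ^ 2 : ℂ) ≠ 0 := by
    have : (Real.pi : ℂ) ≠ 0 := by exact_mod_cast Real.pi_ne_zero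
    have : (r : ℂ) ≠ 0 := by exact_mod_cast hr.ne'
    positivity
  have hctop : c ≠ ∞ := ENNReal.mul_ne_top (by simpa using hpi) ENNReal.ofReal_ne_top
  refine ⟨c ^ 2 * V * ENNReal.ofReal Real.pi, ?_, fun h hh => ?_⟩
  · exact ENNReal.mul_ne_top (ENNReal.mul_ne_top (by simpa using hctop)
      measure_ball_lt_top.ne) ENNReal.ofReal_ne_top
  · rw [mem_bergmanFun_iff] at hh
    have hi : IntegrableOn h (Metric.ball 0 r) :=
      (integrable_area_iff.1 (hh.2.integrable (by norm_num))).mono_set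
        (Metric.ball_subset_ball hr1)
    have hmean := hh.1.setIntegral_mul_momentPolynomial hn hr hr1 hi
    have h1 : ‖h 0‖ₑ ≤ c * ∫⁻ v in Metric.ball 0 r, ‖h v‖ₑ := by
      have h2 : ‖(Real.pi * r ^ 2 : ℂ)‖ₑ * ‖h 0‖ₑ ≤
          ENNReal.ofReal M * ∫⁻ v in Metric.ball 0 r, ‖h v‖ₑ := by
        rw [← enorm_mul, ← hmean, ← lintegral_const_mul' _ _ ENNReal.ofReal_ne_top]
        refine (enorm_integral_le_lintegral_enorm _).trans (setLIntegral_mono' measurableSet_ball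
          fun v hv => ?_)
        rw [enorm_mul, mul_comm]
        gcongr
        rw [← ofReal_norm]
        exact ENNReal.ofReal_le_ofReal (hM v (Metric.ball_subset_closedBall hv))
      rw [hc, mul_assoc, mul_comm, ← div_eq_mul_inv]
      rw [ENNReal.le_div_iff_mul_le (Or.inl (by simpa using hpi)) (Or.inl enorm_ne_top), mul_comm]
      exact h2
    calc ‖h 0‖ₑ ^ 2 ≤ (c * ∫⁻ v in Metric.ball 0 r, ‖h v‖ₑ) ^ 2 := by gcongr
      _ ≤ c ^ 2 * (V * ∫⁻ v in Metric.ball 0 r, ‖h v‖ₑ ^ 2) := by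
        rw [mul_pow]
        gcongr
        refine (lintegral_sq_le_measure_mul hi.aestronglyMeasurable.enorm).trans ?_
        rw [Measure.restrict_apply_univ]
      _ = _ := by
        rw [setLIntegral_ball_eq hr1]
        ring

theorem lintegral_mul_transport {n : ℕ} (hn : 1 ≤ n) {a : ℂ} (ha : a ∈ unitDisk) (h : ℂ → ℂ)
    (χ : ℂ → ℝ≥0∞) :
    ∫⁻ w, χ w * ‖transport n a h w‖ₑ ^ 2 ∂area =
      ENNReal.ofReal ((1 - ‖a‖ ^ 2) ^ 2)⁻¹ * ∫⁻ w, χ (mobius a w) * ‖h w‖ₑ ^ 2 ∂area := by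
  rw [lintegral_mobius ha fun w => χ (mobius a w) * ‖h w‖ₑ ^ 2,
    ← lintegral_const_mul' _ _ ENNReal.ofReal_ne_top]
  refine lintegral_congr_ae ?_
  filter_upwards [ae_mem_unitDisk] with w hw
  rw [transport, enorm_mul, mul_pow, mobius_mobius ha hw, ← mul_assoc _ (ENNReal.ofReal _),
    ← ENNReal.ofReal_mul (by positivity), ← norm_transportWeight_sq hn ha hw,
    ENNReal.ofReal_pow (norm_nonneg _), ofReal_norm]
  ring

/-- The indicator function of the pseudohyperbolic disk of radius `r` around `w`. -/
noncomputable def pseudoDisk (r : ℝ) (w u : ℂ) : ℝ≥0∞ :=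
  (Metric.ball (0 : ℂ) r).indicator 1 (mobius w u)

theorem pseudoDisk_of_lt {r : ℝ} {w u : ℂ} (h : ‖mobius w u‖ < r) : pseudoDisk r w u = 1 :=
  Set.indicator_of_mem (by simpa using h) _

theorem pseudoDisk_of_le {r : ℝ} {w u : ℂ} (h : r ≤ ‖mobius w u‖) : pseudoDisk r w u = 0 :=
  Set.indicator_of_notMem (by simpa using h) _

theorem pseudoDisk_comm (r : ℝ) (w u : ℂ) : pseudoDisk r w u = pseudoDisk r u w := by
  rcases lt_or_ge ‖mobius w u‖ r with h | h
  · rw [pseudoDisk_of_lt h, pseudoDisk_of_lt (norm_mobius_comm w u ▸ h)]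
  · rw [pseudoDisk_of_le h, pseudoDisk_of_le (norm_mobius_comm w u ▸ h)]

theorem measurable_pseudoDisk (r : ℝ) : Measurable fun p : ℂ × ℂ => pseudoDisk r p.1 p.2 := by
  refine (measurable_one.indicator measurableSet_ball).comp ?_
  unfold mobius
  have : Measurable fun p : ℂ × ℂ => conj p.1 :=
    Complex.continuous_conj.measurable.comp measurable_fst
  fun_prop

/-- The sub-mean value property on pseudohyperbolic disks. -/
theorem exists_enorm_apply_sq_le {n : ℕ} (hn : 1 ≤ n) {r : ℝ} (hr : 0 < r) (hr1 : r ≤ 1) :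
    ∃ C : ℝ≥0∞, C ≠ ∞ ∧ ∀ h ∈ bergmanFun n, ∀ w ∈ unitDisk,
      ‖h w‖ₑ ^ 2 ≤ C * (ENNReal.ofReal ((1 - ‖w‖ ^ 2) ^ 2)⁻¹ *
        ∫⁻ u, pseudoDisk r w u * ‖h u‖ₑ ^ 2 ∂area) := by
  obtain ⟨C, hC, hle⟩ := exists_enorm_apply_zero_sq_le hn hr hr1
  refine ⟨C, hC, fun h hh w hw => ?_⟩
  have := hle _ (transport_mem hn hw hh)
  -- Transport moves the value at w to the origin, where the inequality is already known.
  have h0 : transport n w h 0 = h w := by simp [transport, transportWeight]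
  rw [h0] at this
  refine this.trans (le_of_eq ?_)
  congr 1
  have h1 := lintegral_mul_transport hn hw h ((Metric.ball (0 : ℂ) r).indicator 1)
  refine Eq.trans ?_ h1
  refine lintegral_congr fun v => ?_
  by_cases hv : v ∈ Metric.ball (0 : ℂ) r <;> simp [hv]

/-- Insert |1 - ūw| ≥ 1 - |u| in the formula for 1 - |φ_u(w)|² and cancel one factor 1 - |u|.
Multiplying by 1 + |u| leaves (1 + |u|)² ≤ 4, the source of the constant. -/
theorem one_sub_sq_le_of_mobius {r : ℝ} (hr1 : r < 1) {u w : ℂ} (hu : u ∈ unitDisk)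
    (hw : w ∈ unitDisk) (h : ‖mobius u w‖ < r) :
    1 - ‖u‖ ^ 2 ≤ 4 * (1 - ‖w‖ ^ 2) / (1 - r ^ 2) := by
  have h1 := one_sub_norm_mobius_sq hu hw
  have hn := norm_nonneg (mobius u w)
  have hr : 0 < r := hn.trans_lt h
  have h2 : 1 - r ^ 2 ≤ 1 - ‖mobius u w‖ ^ 2 := by nlinarith
  have hd : 0 < 1 - r ^ 2 := by nlinarith
  have hu' := mem_unitDisk.1 hu
  have h3 : 1 - ‖u‖ ≤ ‖1 - conj u * w‖ := one_sub_norm_le hw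
  have h4 : (1 - ‖u‖) ^ 2 ≤ ‖1 - conj u * w‖ ^ 2 :=
    pow_le_pow_left₀ (by linarith) h3 2
  have h5 : 0 < (1 - ‖u‖) ^ 2 := by
    have : 0 < 1 - ‖u‖ := by linarith
    positivity
  rw [h1, le_div_iff₀ (h5.trans_le h4)] at h2
  have h6 : (1 - r ^ 2) * (1 - ‖u‖) ^ 2 ≤ (1 - ‖u‖ ^ 2) * (1 - ‖w‖ ^ 2) :=
    (mul_le_mul_of_nonneg_left h4 hd.le).trans h2
  have hu0 := norm_nonneg u
  have hwp := one_sub_sq_pos hw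
  have h7 : (1 - r ^ 2) * (1 - ‖u‖) ≤ (1 + ‖u‖) * (1 - ‖w‖ ^ 2) := by
    have : 0 < 1 - ‖u‖ := by linarith
    refine le_of_mul_le_mul_right ?_ this
    nlinarith
  rw [le_div_iff₀ hd]
  nlinarith

theorem integral_norm_kernel_sq {n : ℕ} (hn : 1 ≤ n) {z : ℂ} (hz : z ∈ unitDisk) :
    ∫ v, ‖kernel n z v‖ ^ 2 ∂area = (momentPolynomial n).eval 0 / (1 - ‖z‖ ^ 2) ^ 2 := by
  rw [← norm_kernelVector_sq hn hz]
  have h1 := inner_toBergman ⟨kernel n z, kernel_mem n z⟩ ⟨kernel n z, kernel_mem n z⟩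
  have h2 : inner ℂ (kernelVector n z) (kernelVector n z) =
      ∫ w, ((‖kernel n z w‖ ^ 2 : ℝ) : ℂ) ∂area := by
    rw [kernelVector, h1]
    refine integral_congr_ae (ae_of_all _ fun w => ?_)
    simp only [Complex.mul_conj', Complex.ofReal_pow]
  rw [integral_complex_ofReal] at h2
  refine Eq.symm ((norm_sq_eq_re_inner (𝕜 := ℂ) (kernelVector n z)).trans ?_)
  rw [h2]
  exact Complex.ofReal_re _

theorem norm_normalizedKernel_sq {n : ℕ} (hn : 1 ≤ n) {u w : ℂ} (hu : u ∈ unitDisk)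
    (hw : w ∈ unitDisk) :
    ‖normalizedKernel n u w‖ ^ 2 = mobiusJacobian u w *
      ((momentPolynomial n).eval (‖mobius u w‖ ^ 2)) ^ 2 / (momentPolynomial n).eval 0 := by
  have hq := momentPolynomial_eval_zero_pos hn
  have hu' := one_sub_sq_pos hu
  rw [normalizedKernel, kernel_eq_explicitKernel hn hu hw, norm_div, div_pow, Complex.norm_real,
    Real.norm_eq_abs, sq_abs, Real.sq_sqrt (integral_nonneg fun v => sq_nonneg _),
    integral_norm_kernel_sq hn hu, explicitKernel, transport, norm_mul, mul_pow,
    norm_transportWeight_sq hn hu hw, centralKernel, Complex.norm_real, Real.norm_eq_abs, sq_abs]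
  field_simp

/-- By continuity q(t²) > q(0)/2 for small t, so r must be small enough to avoid the zeros of q. On
the pseudohyperbolic disk, J = (1-|φ_u(w)|²)²/(1-|w|²)² is at least (1-r²)²/(1-|w|²)². -/
theorem exists_pseudoDisk_le_normalizedKernel {n : ℕ} (hn : 1 ≤ n) :
    ∃ r : ℝ, 0 < r ∧ r < 1 ∧ ∃ C : ℝ≥0∞, C ≠ ∞ ∧ ∀ u ∈ unitDisk, ∀ w ∈ unitDisk,
      pseudoDisk r u w * ENNReal.ofReal ((1 - ‖w‖ ^ 2) ^ 2)⁻¹ ≤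
        C * ‖normalizedKernel n u w‖ₑ ^ 2 := by
  set q0 := (momentPolynomial n).eval 0 with hq0
  have hq := momentPolynomial_eval_zero_pos hn
  have hev : ∀ᶠ t in 𝓝 (0 : ℝ), q0 / 2 < (momentPolynomial n).eval (t ^ 2) := by
    have : Continuous fun t : ℝ => (momentPolynomial n).eval (t ^ 2) := by
      have := (momentPolynomial n).continuous
      fun_prop
    refine this.continuousAt.eventually_const_lt ?_
    simp only [ne_eq, OfNat.ofNat_ne_zero, not_false_eq_true, zero_pow]
    linarith
  obtain ⟨δ, hδ, hball⟩ := Metric.eventually_nhds_iff.1 hev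
  set r := min δ (1 / 2) with hr
  have hr0 : 0 < r := lt_min hδ (by norm_num)
  have hr1 : r < 1 := (min_le_right _ _).trans_lt (by norm_num)
  have hd : 0 < 1 - r ^ 2 := by nlinarith
  -- The constant inverts (1-r²)² (q(0)/2)² / q(0), the lower bound for |k_u(w)|² (1-|w|²)².
  refine ⟨r, hr0, hr1, ENNReal.ofReal (((1 - r ^ 2) ^ 2 * q0 / 4)⁻¹), ENNReal.ofReal_ne_top,
    fun u hu w hw => ?_⟩
  rcases le_or_gt r ‖mobius u w‖ with h | h
  · rw [pseudoDisk_of_le h, zero_mul]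
    exact zero_le
  · rw [pseudoDisk_of_lt h, one_mul, ← ofReal_norm, ← ENNReal.ofReal_pow (norm_nonneg _),
      ← ENNReal.ofReal_mul (by positivity)]
    refine ENNReal.ofReal_le_ofReal ?_
    rw [norm_normalizedKernel_sq hn hu hw]
    have h1 := one_sub_norm_mobius_sq hu hw
    have hn0 := norm_nonneg (mobius u w)
    have h2 : 1 - r ^ 2 ≤ 1 - ‖mobius u w‖ ^ 2 := by nlinarith
    have hw' := one_sub_sq_pos hw
    have hJ : mobiusJacobian u w = (1 - ‖mobius u w‖ ^ 2) ^ 2 / (1 - ‖w‖ ^ 2) ^ 2 := by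
      rw [h1, mobiusJacobian]
      field_simp
    have h3 : q0 / 2 < (momentPolynomial n).eval (‖mobius u w‖ ^ 2) := by
      refine hball ?_
      rw [Real.dist_eq, sub_zero, abs_of_nonneg hn0]
      exact h.trans_le (min_le_left _ _)
    have h4 : (q0 / 2) ^ 2 ≤ (momentPolynomial n).eval (‖mobius u w‖ ^ 2) ^ 2 :=
      pow_le_pow_left₀ (by positivity) h3.le 2
    have h5 : (1 - r ^ 2) ^ 2 ≤ (1 - ‖mobius u w‖ ^ 2) ^ 2 := pow_le_pow_left₀ hd.le h2 2
    rw [hJ]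
    calc ((1 - ‖w‖ ^ 2) ^ 2)⁻¹
        = ((1 - r ^ 2) ^ 2 * q0 / 4)⁻¹ *
          ((1 - r ^ 2) ^ 2 / (1 - ‖w‖ ^ 2) ^ 2 * (q0 / 2) ^ 2 / q0) := by
          have : q0 ≠ 0 := hq.ne'
          field_simp
          norm_num
      _ ≤ _ := by gcongr

theorem aemeasurable_ofReal {f : ℂ → ℝ} (hf : Integrable f area) :
    AEMeasurable (fun w => ENNReal.ofReal (f w)) area :=
  hf.aestronglyMeasurable.aemeasurable.ennreal_ofReal

/-- The Carleson embedding estimate, from a bound of the Berezin transform near the boundary. -/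
theorem exists_setLIntegral_le {n : ℕ} (hn : 1 ≤ n) {f : ℂ → ℝ} (hf : Integrable f area) :
    ∃ C : ℝ≥0∞, C ≠ ∞ ∧ ∃ r : ℝ, 0 < r ∧ r < 1 ∧ ∀ (R : ℝ) (ε : ℝ≥0∞), 0 ≤ R →
      (∀ u ∈ unitDisk, 1 - ‖u‖ ^ 2 ≤ 4 * (1 - R ^ 2) / (1 - r ^ 2) →
        ∫⁻ w, ENNReal.ofReal (f w) * ‖normalizedKernel n u w‖ₑ ^ 2 ∂area ≤ ε) →
      ∀ h ∈ bergmanFun n, ∫⁻ w in {w | R ≤ ‖w‖}, ENNReal.ofReal (f w) * ‖h w‖ₑ ^ 2 ∂area ≤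
        C * ε * ∫⁻ w, ‖h w‖ₑ ^ 2 ∂area := by
  obtain ⟨r, hr0, hr1, C', hC', hle'⟩ := exists_pseudoDisk_le_normalizedKernel hn
  obtain ⟨C, hC, hle⟩ := exists_enorm_apply_sq_le hn hr0 hr1.le
  refine ⟨C * C', ENNReal.mul_ne_top hC hC', r, hr0, hr1, fun R ε hR0 hε h hh => ?_⟩
  have hS : MeasurableSet {w : ℂ | R ≤ ‖w‖} := measurableSet_le measurable_const measurable_norm
  have hd : 0 < 1 - r ^ 2 := by nlinarith
  set F : ℂ → ℝ≥0∞ := fun w => ENNReal.ofReal (f w)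
  have hF : AEMeasurable F area := aemeasurable_ofReal hf
  have hhm : AEMeasurable (fun u => ‖h u‖ₑ ^ 2) area :=
    hh.2.aestronglyMeasurable.enorm.pow_const 2
  set χ : ℂ → ℝ≥0∞ := {w : ℂ | R ≤ ‖w‖}.indicator 1
  have hχ : Measurable χ := measurable_one.indicator hS
  set G : ℂ → ℝ≥0∞ := fun w => ENNReal.ofReal ((1 - ‖w‖ ^ 2) ^ 2)⁻¹
  have hG : Measurable G := by fun_prop
  calc ∫⁻ w in {w | R ≤ ‖w‖}, F w * ‖h w‖ₑ ^ 2 ∂area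
      = ∫⁻ w, χ w * (F w * ‖h w‖ₑ ^ 2) ∂area := by
        rw [← lintegral_indicator hS]
        refine lintegral_congr fun w => ?_
        by_cases hw : R ≤ ‖w‖ <;> simp [χ, hw]
    _ ≤ ∫⁻ w, χ w * (F w * (C * (G w * ∫⁻ u, pseudoDisk r w u * ‖h u‖ₑ ^ 2 ∂area))) ∂area := by
        refine lintegral_mono_ae ?_
        filter_upwards [ae_mem_unitDisk] with w hw
        gcongr
        exact hle h hh w hw
    _ = C * ∫⁻ w, ∫⁻ u, (χ w * F w * G w) * (pseudoDisk r w u * ‖h u‖ₑ ^ 2) ∂area ∂area := by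
        rw [← lintegral_const_mul' _ _ hC]
        refine lintegral_congr fun w => ?_
        rw [lintegral_const_mul'']
        · ring
        · exact ((measurable_pseudoDisk r).comp
            (measurable_const.prodMk measurable_id)).aemeasurable.mul hhm
    -- Tonelli: the inner integral over w is then compared with the Berezin transform at u.
    _ = C * ∫⁻ u, ∫⁻ w, (χ w * F w * G w) * (pseudoDisk r w u * ‖h u‖ₑ ^ 2) ∂area ∂area := by
        rw [lintegral_lintegral_swap]
        have h1 : AEMeasurable (fun w => χ w * F w * G w) area :=
          (hχ.aemeasurable.mul hF).mul hG.aemeasurable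
        exact h1.comp_fst.mul ((measurable_pseudoDisk r).aemeasurable.mul hhm.comp_snd)
    _ ≤ C * ∫⁻ u, C' * ε * ‖h u‖ₑ ^ 2 ∂area := by
        gcongr 1
        refine lintegral_mono_ae ?_
        filter_upwards [ae_mem_unitDisk] with u hu
        have h2 : ∫⁻ w, (χ w * F w * G w) * pseudoDisk r w u ∂area ≤ C' * ε := by
          -- Either u is close enough to the boundary for the hypothesis on ε to apply, or its
          -- pseudohyperbolic disk misses {|w| ≥ R} and the integrand is 0.
          by_cases hcase : 1 - ‖u‖ ^ 2 ≤ 4 * (1 - R ^ 2) / (1 - r ^ 2)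
          · refine le_trans ?_ (mul_le_mul_right (hε u hu hcase) C')
            rw [← lintegral_const_mul' _ _ hC']
            refine lintegral_mono_ae ?_
            filter_upwards [ae_mem_unitDisk] with w hw
            have hχ1 : χ w ≤ 1 := Set.indicator_le_self' (fun _ _ => zero_le) w
            calc χ w * F w * G w * pseudoDisk r w u
                ≤ 1 * F w * G w * pseudoDisk r w u := by gcongr
              _ = F w * (pseudoDisk r u w * G w) := by
                rw [pseudoDisk_comm]
                ring
              _ ≤ F w * (C' * ‖normalizedKernel n u w‖ₑ ^ 2) := by
                exact mul_le_mul_right (hle' u hu w hw) _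
              _ = _ := by ring
          · refine le_of_eq_of_le ?_ zero_le
            rw [← lintegral_zero (μ := area)]
            refine lintegral_congr_ae ?_
            filter_upwards [ae_mem_unitDisk] with w hw
            by_cases hwR : R ≤ ‖w‖
            · have : r ≤ ‖mobius w u‖ := by
                by_contra! hlt
                rw [norm_mobius_comm] at hlt
                refine hcase ((one_sub_sq_le_of_mobius hr1 hu hw hlt).trans ?_)
                gcongr
              rw [pseudoDisk_of_le this, mul_zero]
            · simp [χ, hwR]
        calc ∫⁻ w, (χ w * F w * G w) * (pseudoDisk r w u * ‖h u‖ₑ ^ 2) ∂area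
            = (∫⁻ w, (χ w * F w * G w) * pseudoDisk r w u ∂area) * ‖h u‖ₑ ^ 2 := by
              rw [← lintegral_mul_const' _ _ (by simp)]
              exact lintegral_congr fun w => by ring
          _ ≤ C' * ε * ‖h u‖ₑ ^ 2 := by gcongr
    _ = C * C' * ε * ∫⁻ w, ‖h w‖ₑ ^ 2 ∂area := by
        rw [lintegral_const_mul'' _ hhm]
        ring

theorem exists_bound_kernel {n : ℕ} (hn : 1 ≤ n) {z : ℂ} (hz : z ∈ unitDisk) :
    ∃ C : ℝ, ∀ w ∈ unitDisk, ‖kernel n z w‖ ≤ C := by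
  obtain ⟨C, hC0, hC⟩ := exists_bound_centralKernel n
  refine ⟨((1 - ‖z‖) ^ 2)⁻¹ * C, fun w hw => ?_⟩
  have hz' : 0 < 1 - ‖z‖ := by linarith [mem_unitDisk.1 hz]
  rw [kernel_eq_explicitKernel hn hz hw, explicitKernel, transport, norm_mul,
    norm_transportWeight hn hz hw]
  gcongr
  · exact one_sub_norm_le hw
  · exact hC _ (mobius_mem hz hw)

/-- Kernel functions are bounded, so the integrand is integrable; as f ≥ 0, the complex integral can
then be read as a lower Lebesgue integral, the form used in the Carleson estimate. -/
theorem enorm_berezin {n : ℕ} (hn : 1 ≤ n) {f : ℂ → ℝ} (hf : Integrable f area)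
    (hf0 : ∀ᵐ w ∂area, 0 ≤ f w) {u : ℂ} (hu : u ∈ unitDisk) :
    ‖berezin n (fun w => (f w : ℂ)) u‖ₑ =
      ∫⁻ w, ENNReal.ofReal (f w) * ‖normalizedKernel n u w‖ₑ ^ 2 ∂area := by
  have h1 : berezin n (fun w => (f w : ℂ)) u =
      ((∫ w, f w * ‖normalizedKernel n u w‖ ^ 2 ∂area : ℝ) : ℂ) := by
    rw [berezin, ← integral_complex_ofReal]
    simp only [Complex.ofReal_mul]
  have hm : AEStronglyMeasurable (normalizedKernel n u) area := by
    have := (kernel_mem n u).2.aestronglyMeasurable.mul_const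
      ((Real.sqrt (∫ v, ‖kernel n u v‖ ^ 2 ∂area) : ℂ)⁻¹)
    exact this
  have hi : Integrable (fun w => f w * ‖normalizedKernel n u w‖ ^ 2) area := by
    obtain ⟨C, hC⟩ := exists_bound_kernel hn hu
    refine hf.mul_bdd (c := (C / Real.sqrt (∫ v, ‖kernel n u v‖ ^ 2 ∂area)) ^ 2)
      (hm.norm.pow 2) ?_
    filter_upwards [ae_mem_unitDisk] with w hw
    rw [Real.norm_eq_abs, abs_of_nonneg (by positivity), normalizedKernel, norm_div,
      Complex.norm_real, Real.norm_eq_abs, abs_of_nonneg (Real.sqrt_nonneg _)]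
    gcongr
    exact hC w hw
  have h0 : 0 ≤ᵐ[area] fun w => f w * ‖normalizedKernel n u w‖ ^ 2 := by
    filter_upwards [hf0] with w hw
    exact mul_nonneg hw (sq_nonneg _)
  rw [h1, ← ofReal_norm, Complex.norm_real, Real.norm_eq_abs,
    abs_of_nonneg (integral_nonneg_of_ae h0), ofReal_integral_eq_lintegral_ofReal hi h0]
  refine lintegral_congr_ae ?_
  filter_upwards [hf0] with w hw
  rw [ENNReal.ofReal_mul hw, ENNReal.ofReal_pow (norm_nonneg _), ofReal_norm]

/-- If the Berezin transform vanishes at the boundary, then `f dA` is a vanishing Carleson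
measure. -/
theorem exists_setLIntegral_le_of_tendsto_berezin {n : ℕ} (hn : 1 ≤ n) {f : ℂ → ℝ}
    (hf : Integrable f area) (hf0 : ∀ᵐ w ∂area, 0 ≤ f w)
    (hB : Tendsto (fun z => berezin n (fun w => (f w : ℂ)) z) toBoundary (𝓝 0))
    {ε : ℝ} (hε : 0 < ε) :
    ∃ R₀ < 1, ∀ R, R₀ ≤ R → ∀ h ∈ bergmanFun n,
      ∫⁻ w in {w | R ≤ ‖w‖}, ENNReal.ofReal (f w) * ‖h w‖ₑ ^ 2 ∂area ≤
        ENNReal.ofReal ε * ∫⁻ w, ‖h w‖ₑ ^ 2 ∂area := by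
  obtain ⟨C, hC, r, hr0, hr1, hle⟩ := exists_setLIntegral_le hn hf
  have hd : 0 < 1 - r ^ 2 := by nlinarith
  -- Dividing by C + 1 rather than C keeps the denominator nonzero.
  have hη : 0 < ENNReal.ofReal ε / (C + 1) :=
    ENNReal.div_pos (by simpa using hε) (by simpa using hC)
  have hev : ∀ᶠ z in toBoundary, ‖berezin n (fun w => (f w : ℂ)) z‖ₑ <
      ENNReal.ofReal ε / (C + 1) := by
    have := hB.enorm
    rw [enorm_zero] at this
    exact this.eventually_lt_const hη
  obtain ⟨s, hs, hs'⟩ := exists_of_eventually_toBoundary hev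
  set t := max s 0 with ht
  have ht0 : 0 ≤ t := le_max_right _ _
  have ht1 : t < 1 := max_lt hs one_pos
  -- If 1 - R is at most this number, then 4(1-R²) ≤ 8(1-R) ≤ (1-r²)(1-t²)/2. Hence the relevant u
  -- satisfy 1-|u|² ≤ (1-t²)/2 < 1-t², that is |u| > t.
  have hσ : 0 < (1 - r ^ 2) * (1 - t ^ 2) / 16 := by
    have : 0 < 1 - t ^ 2 := by nlinarith
    positivity
  refine ⟨max 0 (1 - (1 - r ^ 2) * (1 - t ^ 2) / 16), max_lt one_pos (by linarith),
    fun R hR h hh => ?_⟩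
  have hR0 : 0 ≤ R := (le_max_left _ _).trans hR
  have hR1 := (le_max_right _ _).trans hR
  refine (hle R (ENNReal.ofReal ε / (C + 1)) hR0 (fun u hu hu' => ?_) h hh).trans ?_
  · rw [← enorm_berezin hn hf hf0 hu]
    refine (hs' u hu ?_).le
    have h1 : 4 * (1 - R ^ 2) ≤ 8 * (1 - R) := by nlinarith [sq_nonneg (1 - R)]
    rw [le_div_iff₀ hd] at hu'
    have h2 : (1 - ‖u‖ ^ 2) * (1 - r ^ 2) ≤ (1 - t ^ 2) / 2 * (1 - r ^ 2) := by linarith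
    have h3 := le_of_mul_le_mul_right h2 hd
    have h4 : 0 < 1 - t ^ 2 := by nlinarith
    have h5 : t ^ 2 < ‖u‖ ^ 2 := by linarith
    exact (le_max_left s 0).trans_lt (lt_of_pow_lt_pow_left₀ 2 (norm_nonneg u) h5)
  · gcongr
    rw [← mul_div_assoc, mul_comm, mul_div_assoc]
    refine mul_le_of_le_one_right' ?_
    exact ENNReal.div_le_of_le_mul (by simp)

/-- The functions in `A²_n` are of order `o(‖K_z‖)` at the boundary. -/
theorem tendsto_mul_apply_toBoundary {n : ℕ} (hn : 1 ≤ n) {h : ℂ → ℂ} (hh : h ∈ bergmanFun n) :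
    Tendsto (fun z => ((1 - ‖z‖ ^ 2 : ℝ) : ℂ) * h z) toBoundary (𝓝 0) := by
  obtain ⟨C, hC, hle⟩ := exists_enorm_apply_sq_le hn (r := 1 / 2) (by norm_num) (by norm_num)
  have hhm : AEMeasurable (fun u => ‖h u‖ₑ ^ 2) area :=
    hh.2.aestronglyMeasurable.enorm.pow_const 2
  -- Dominated convergence with majorant |h|²: each fixed u lies outside the pseudohyperbolic disk
  -- about z once |z| is close to 1.
  have hlim : Tendsto (fun z => ∫⁻ u, pseudoDisk (1 / 2) z u * ‖h u‖ₑ ^ 2 ∂area) toBoundary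
      (𝓝 (∫⁻ _, 0 ∂area)) := by
    refine tendsto_lintegral_filter_of_dominated_convergence' (fun u => ‖h u‖ₑ ^ 2) ?_ ?_ ?_ ?_
    · exact Eventually.of_forall fun z => ((measurable_pseudoDisk _).comp
        (measurable_const.prodMk measurable_id)).aemeasurable.mul hhm
    · refine Eventually.of_forall fun z => ae_of_all _ fun u => ?_
      refine mul_le_of_le_one_left' ?_
      exact Set.indicator_le_self' (fun _ _ => zero_le) _
    · exact ((memLp_two_area_iff (mem_bergmanFun_iff.1 hh).1.continuousOn).1 hh.2).ne
    · filter_upwards [ae_mem_unitDisk] with u hu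
      refine tendsto_const_nhds.congr' ?_
      have hlim : Tendsto (fun z : ℂ => 4 * (1 - ‖z‖ ^ 2) / (1 - (1 / 2) ^ 2)) toBoundary
          (𝓝 0) := by
        have := (((tendsto_norm_toBoundary.pow 2).const_sub 1).const_mul 4).div_const
          (1 - (1 / 2) ^ 2)
        simpa using this
      filter_upwards [eventually_mem_unitDisk, hlim.eventually_lt_const (one_sub_sq_pos hu)]
        with z hz hzu
      rw [pseudoDisk_of_le, zero_mul]
      by_contra! hlt
      rw [norm_mobius_comm] at hlt
      have := one_sub_sq_le_of_mobius (by norm_num) hu hz hlt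
      linarith
  rw [lintegral_zero] at hlim
  have hlim2 := ENNReal.Tendsto.const_mul hlim (Or.inr hC)
  rw [mul_zero] at hlim2
  have hsq : Tendsto (fun z => ‖((1 - ‖z‖ ^ 2 : ℝ) : ℂ) * h z‖ₑ ^ 2) toBoundary (𝓝 0) := by
    refine tendsto_of_tendsto_of_tendsto_of_le_of_le' tendsto_const_nhds hlim2
      (Eventually.of_forall fun _ => zero_le) ?_
    filter_upwards [eventually_mem_unitDisk] with z hz
    have hz' := one_sub_sq_pos hz
    have he : ‖((1 - ‖z‖ ^ 2 : ℝ) : ℂ)‖ₑ = ENNReal.ofReal (1 - ‖z‖ ^ 2) := by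
      rw [← ofReal_norm, Complex.norm_real, Real.norm_eq_abs, abs_of_pos hz']
    rw [enorm_mul, mul_pow, he, ← ENNReal.ofReal_pow hz'.le]
    refine (mul_le_mul_right (hle h hh z hz) _).trans (le_of_eq ?_)
    rw [mul_left_comm, ← mul_assoc (ENNReal.ofReal _), ← ENNReal.ofReal_mul (by positivity),
      mul_inv_cancel₀ (by positivity), ENNReal.ofReal_one, one_mul]
  rw [tendsto_zero_iff_norm_tendsto_zero]
  have h1 := (ENNReal.tendsto_toReal ENNReal.zero_ne_top).comp hsq
  have h2 := h1.sqrt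
  rw [ENNReal.toReal_zero, Real.sqrt_zero] at h2
  refine h2.congr fun z => ?_
  rw [Function.comp_apply, ENNReal.toReal_pow, toReal_enorm]
  exact Real.sqrt_sq (norm_nonneg _)

/-! ### Compact operators as integrals of rank one operators. -/

/-- A closed subspace is complete, so the integral can be formed inside it and pushed forward by the
inclusion. It is applied to the closed subspace of compact operators. -/
theorem integral_mem_of_isClosed {α V : Type*} [MeasurableSpace α] {μ : Measure α}
    [NormedAddCommGroup V] [NormedSpace ℂ V] [CompleteSpace V] (S : Submodule ℂ V)
    (hS : IsClosed (S : Set V)) {φ : α → V} (hφ : Integrable φ μ) (h : ∀ a, φ a ∈ S) :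
    ∫ a, φ a ∂μ ∈ S := by
  have := hS.completeSpace_coe
  have hi : Integrable (fun a => (⟨φ a, h a⟩ : S)) μ :=
    ⟨Topology.IsEmbedding.subtypeVal.aestronglyMeasurable_comp_iff.1 hφ.1, hφ.2⟩
  have h2 := S.subtypeL.integral_comp_comm hi
  simp only [Submodule.subtypeL_apply] at h2
  rw [h2]
  exact (∫ a, (⟨φ a, h a⟩ : S) ∂μ).2

section Hilbert

variable {E : Type*} [NormedAddCommGroup E] [InnerProductSpace ℂ E]

theorem opNorm_le_of_norm_inner_le {S : E →L[ℂ] E} {C : ℝ} (hC : 0 ≤ C)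
    (h : ∀ x y, ‖inner ℂ y (S x)‖ ≤ C * (‖x‖ ^ 2 + ‖y‖ ^ 2)) : ‖S‖ ≤ 2 * C := by
  refine ContinuousLinearMap.opNorm_le_of_re_inner_le (by positivity) fun x y hx hy => ?_
  have := h x y
  rw [norm_inner_symm, hx, hy] at this
  exact (RCLike.re_le_norm _).trans (this.trans_eq (by ring))

theorem isCompactOperator_rankOne (x y : E) :
    IsCompactOperator (InnerProductSpace.rankOne ℂ x y) :=
  (isCompactOperator_of_locallyCompactSpace_dom (innerSL ℂ y)).clm_comp
    (ContinuousLinearMap.toSpanSingleton ℂ x)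

theorem integrable_smul_rankOne {α : Type*} [MeasurableSpace α] {μ : Measure α} {c : α → ℂ}
    {κ : α → E} (hc : Integrable c μ) (hκ : AEStronglyMeasurable κ μ) {C : ℝ}
    (hC : ∀ᵐ a ∂μ, ‖κ a‖ ≤ C) :
    Integrable (fun a => c a • InnerProductSpace.rankOne ℂ (κ a) (κ a)) μ := by
  refine hc.smul_bdd (C * C) ?_ ?_
  · have h2 : Continuous fun x : E => InnerProductSpace.rankOne ℂ x x :=
      ((ContinuousLinearMap.smulRightL ℂ E E).continuous.comp
        (innerSL ℂ (E := E)).continuous).clm_apply continuous_id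
    exact h2.comp_aestronglyMeasurable hκ
  · filter_upwards [hC] with a ha
    rw [InnerProductSpace.norm_rankOne]
    gcongr
    exact (norm_nonneg _).trans ha

/-- A weighted integral of rank one operators is a compact operator. -/
theorem exists_isCompactOperator_inner_eq_integral [CompleteSpace E] {α : Type*}
    [MeasurableSpace α] {μ : Measure α} {c : α → ℂ} {κ : α → E} (hc : Integrable c μ)
    (hκ : AEStronglyMeasurable κ μ) {C : ℝ} (hC : ∀ᵐ a ∂μ, ‖κ a‖ ≤ C) :
    ∃ A : E →L[ℂ] E, IsCompactOperator A ∧ ∀ x y : E,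
      inner ℂ y (A x) = ∫ a, c a * inner ℂ (κ a) x * inner ℂ y (κ a) ∂μ := by
  have hi := integrable_smul_rankOne hc hκ hC
  refine ⟨∫ a, c a • InnerProductSpace.rankOne ℂ (κ a) (κ a) ∂μ, ?_, fun x y => ?_⟩
  · refine integral_mem_of_isClosed (compactOperator (RingHom.id ℂ) E E)
      isClosed_setOfPred_isCompactOperator hi fun a => ?_
    exact (compactOperator (RingHom.id ℂ) E E).smul_mem _ (isCompactOperator_rankOne _ _)
  · rw [ContinuousLinearMap.integral_apply hi, ← innerSL_apply_apply ℂ,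
      ← ContinuousLinearMap.integral_comp_comm _ (hi.apply_continuousLinearMap x)]
    congr 1
    funext a
    simp only [smul_apply, InnerProductSpace.rankOne_apply, innerSL_apply_apply, inner_smul_right,
      mul_assoc]

end Hilbert

/-! ### Sufficiency: truncated Toeplitz operators and their limit. -/

theorem norm_toBergman_sq {n : ℕ} (h : bergmanFun n) :
    ENNReal.ofReal (‖toBergman n h‖ ^ 2) = ∫⁻ w, ‖h.1 w‖ₑ ^ 2 ∂area := by
  rw [← enorm_toBergman_sq, ENNReal.ofReal_pow (norm_nonneg _), ofReal_norm]

theorem toBergman_congr {n : ℕ} {g h : bergmanFun n} (e : Set.EqOn g.1 h.1 unitDisk) :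
    toBergman n g = toBergman n h := by
  refine Subtype.ext (MemLp.toLp_congr g.2.2 h.2.2 ?_)
  filter_upwards [ae_mem_unitDisk] with w hw
  exact e hw

theorem mem_bergmanFun_congr {n : ℕ} {g h : ℂ → ℂ} (hh : h ∈ bergmanFun n)
    (e : Set.EqOn g h unitDisk) : g ∈ bergmanFun n := by
  rw [mem_bergmanFun_iff] at hh ⊢
  refine ⟨hh.1.congr e, (memLp_congr_ae ?_).1 hh.2⟩
  filter_upwards [ae_mem_unitDisk] with w hw
  exact (e hw).symm

theorem exists_bound_of_mem_kernelSpan {n : ℕ} (hn : 1 ≤ n) {h : ℂ → ℂ} (hh : h ∈ kernelSpan n) :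
    ∃ C : ℝ, ∀ w ∈ unitDisk, ‖h w‖ ≤ C := by
  induction hh using Submodule.span_induction with
  | mem x hx =>
    obtain ⟨z, hz, rfl⟩ := hx
    exact exists_bound_kernel hn hz
  | zero => exact ⟨0, fun w _ => by simp⟩
  | add x y _ _ hx hy =>
    obtain ⟨C, hC⟩ := hx
    obtain ⟨D, hD⟩ := hy
    exact ⟨C + D, fun w hw => (norm_add_le _ _).trans (add_le_add (hC w hw) (hD w hw))⟩
  | smul c x _ hx =>
    obtain ⟨C, hC⟩ := hx
    refine ⟨‖c‖ * C, fun w hw => ?_⟩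
    rw [Pi.smul_apply, norm_smul]
    exact mul_le_mul_of_nonneg_left (hC w hw) (norm_nonneg _)

theorem kernel_mem_kernelSpan {n : ℕ} {z : ℂ} (hz : z ∈ unitDisk) : kernel n z ∈ kernelSpan n :=
  Submodule.subset_span ⟨z, hz, rfl⟩

/-- Linear combinations of kernel functions are bounded on the disk, so the Toeplitz integral
converges absolutely for every f in L¹. -/
theorem integrable_toeplitz {n : ℕ} (hn : 1 ≤ n) {f : ℂ → ℝ} (hf : Integrable f area) {h : ℂ → ℂ}
    (hh : h ∈ kernelSpan n) {z : ℂ} (hz : z ∈ unitDisk) :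
    Integrable (fun w => (f w : ℂ) * h w * conj (kernel n z w)) area := by
  obtain ⟨C, hC⟩ := exists_bound_of_mem_kernelSpan hn hh
  obtain ⟨D, hD⟩ := exists_bound_kernel hn hz
  refine (hf.ofReal.mul_bdd (c := C) (kernelSpan_le n hh).2.aestronglyMeasurable ?_).mul_bdd
    (c := D) (kernel_mem n z).2.aestronglyMeasurable.star ?_
  · filter_upwards [ae_mem_unitDisk] with w hw using hC w hw
  · filter_upwards [ae_mem_unitDisk] with w hw
    exact (Complex.norm_conj _).trans_le (hD w hw)

/-- The compact Toeplitz operator whose symbol is `f` restricted to the disk of radius `R`. -/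
theorem exists_truncatedToeplitz {n : ℕ} (hn : 1 ≤ n) {f : ℂ → ℝ} (hf : Integrable f area) {R : ℝ}
    (hR : R < 1) :
    ∃ A : bergmanSpace n →L[ℂ] bergmanSpace n, IsCompactOperator A ∧ ∀ g h : bergmanFun n,
      inner ℂ (toBergman n g) (A (toBergman n h)) =
        ∫ w in Metric.ball 0 R, (f w : ℂ) * h.1 w * conj (g.1 w) ∂area := by
  have := completeSpace_bergmanSpace hn
  have hc := continuousOn_kernelVector hn
  obtain ⟨C, hC⟩ := (isCompact_closedBall (0 : ℂ) R).exists_bound_of_continuousOn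
    (hc.mono (Metric.closedBall_subset_ball hR))
  obtain ⟨A, hA, hAe⟩ := exists_isCompactOperator_inner_eq_integral (C := C)
    (μ := area.restrict (Metric.ball 0 R)) hf.ofReal.integrableOn
    (aestronglyMeasurable_area hc).restrict (by
      filter_upwards [ae_restrict_mem measurableSet_ball] with w hw
      exact hC w (Metric.ball_subset_closedBall hw))
  refine ⟨A, hA, fun g h => ?_⟩
  rw [hAe]
  refine setIntegral_congr_fun measurableSet_ball fun w hw => ?_
  have hwD : w ∈ unitDisk := Metric.ball_subset_ball hR.le hw
  have hgw := congrArg conj (inner_kernelVector hn hwD g)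
  rw [inner_conj_symm] at hgw
  simp only [inner_kernelVector hn hwD h, hgw]
  rfl

/-- The sesquilinear form of A' - A is an integral over the annulus R ≤ |w| < R'. There |f h ḡ| ≤
f|h|² + f|g|², and the Carleson bound controls both terms; unit vectors h and g account for the
factor 2. -/
theorem norm_sub_le_of_inner_eq_setIntegral {n : ℕ} {f : ℂ → ℝ} (hf : Integrable f area)
    (hf0 : ∀ᵐ w ∂area, 0 ≤ f w) {ε R R' : ℝ} (hε : 0 ≤ ε) (hRR : R ≤ R') (hR' : R' < 1)
    (hle : ∀ h ∈ bergmanFun n,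
      ∫⁻ w in {w | R ≤ ‖w‖}, ENNReal.ofReal (f w) * ‖h w‖ₑ ^ 2 ∂area ≤
        ENNReal.ofReal ε * ∫⁻ w, ‖h w‖ₑ ^ 2 ∂area)
    {A A' : bergmanSpace n →L[ℂ] bergmanSpace n}
    (hA : ∀ g h : bergmanFun n, inner ℂ (toBergman n g) (A (toBergman n h)) =
      ∫ w in Metric.ball 0 R, (f w : ℂ) * h.1 w * conj (g.1 w) ∂area)
    (hA' : ∀ g h : bergmanFun n, inner ℂ (toBergman n g) (A' (toBergman n h)) =
      ∫ w in Metric.ball 0 R', (f w : ℂ) * h.1 w * conj (g.1 w) ∂area) :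
    ‖A' - A‖ ≤ 2 * ε := by
  refine opNorm_le_of_norm_inner_le hε fun x y => ?_
  obtain ⟨h, rfl⟩ := toBergman_surjective n x
  obtain ⟨g, rfl⟩ := toBergman_surjective n y
  have hsub : Metric.ball (0 : ℂ) R ⊆ Metric.ball 0 R' := Metric.ball_subset_ball hRR
  have hint : IntegrableOn (fun w => (f w : ℂ) * h.1 w * conj (g.1 w)) (Metric.ball 0 R') area := by
    have hb : ∀ u : bergmanFun n, ∃ C : ℝ, ∀ w ∈ Metric.ball 0 R', ‖u.1 w‖ ≤ C := by
      intro u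
      obtain ⟨C, hC⟩ := (isCompact_closedBall (0 : ℂ) R').exists_bound_of_continuousOn
        ((mem_bergmanFun_iff.1 u.2).1.continuousOn.mono (Metric.closedBall_subset_ball hR'))
      exact ⟨C, fun w hw => hC w (Metric.ball_subset_closedBall hw)⟩
    obtain ⟨C, hC⟩ := hb h
    obtain ⟨D, hD⟩ := hb g
    refine Integrable.mul_bdd (c := D) (Integrable.mul_bdd (c := C) hf.ofReal.integrableOn
      h.2.2.aestronglyMeasurable.restrict ?_) g.2.2.aestronglyMeasurable.star.restrict ?_
    · filter_upwards [ae_restrict_mem measurableSet_ball] with w hw using hC w hw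
    · filter_upwards [ae_restrict_mem measurableSet_ball] with w hw
      exact (Complex.norm_conj _).trans_le (hD w hw)
  rw [sub_apply, inner_sub_right, hA', hA, ← setIntegral_sdiff measurableSet_ball hint hsub]
  have hS : MeasurableSet {w : ℂ | R ≤ ‖w‖} := measurableSet_le measurable_const measurable_norm
  have hFm : AEMeasurable (fun w => ENNReal.ofReal (f w)) area := aemeasurable_ofReal hf
  have hm : AEMeasurable (fun w => ENNReal.ofReal (f w) * ‖h.1 w‖ₑ ^ 2) area :=
    hFm.mul (h.2.2.aestronglyMeasurable.enorm.pow_const 2)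
  have key : ‖∫ w in Metric.ball 0 R' \ Metric.ball 0 R,
      (f w : ℂ) * h.1 w * conj (g.1 w) ∂area‖ₑ ≤
        ENNReal.ofReal (ε * (‖toBergman n h‖ ^ 2 + ‖toBergman n g‖ ^ 2)) := by
    calc _ ≤ ∫⁻ w in Metric.ball 0 R' \ Metric.ball 0 R,
          ‖(f w : ℂ) * h.1 w * conj (g.1 w)‖ₑ ∂area := enorm_integral_le_lintegral_enorm _
      _ ≤ ∫⁻ w in {w | R ≤ ‖w‖}, ‖(f w : ℂ) * h.1 w * conj (g.1 w)‖ₑ ∂area := by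
        refine lintegral_mono_set fun w hw => ?_
        simpa using hw.2
      _ ≤ ∫⁻ w in {w | R ≤ ‖w‖}, (ENNReal.ofReal (f w) * ‖h.1 w‖ₑ ^ 2 +
          ENNReal.ofReal (f w) * ‖g.1 w‖ₑ ^ 2) ∂area := by
        refine lintegral_mono_ae ?_
        filter_upwards [ae_restrict_of_ae hf0] with w hw
        have e1 : ‖(f w : ℂ)‖ₑ = ENNReal.ofReal (f w) := by
          rw [← ofReal_norm, Complex.norm_real, Real.norm_eq_abs, abs_of_nonneg hw]
        have e2 : ‖conj (g.1 w)‖ₑ = ‖g.1 w‖ₑ := by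
          rw [← ofReal_norm, ← ofReal_norm, Complex.norm_conj]
        rw [enorm_mul, enorm_mul, e1, e2, mul_assoc, ← mul_add]
        gcongr
        rcases le_total ‖h.1 w‖ₑ ‖g.1 w‖ₑ with hle | hle
        · exact le_add_left ((mul_le_mul_left hle _).trans_eq (sq _).symm)
        · exact le_add_right ((mul_le_mul_right hle _).trans_eq (sq _).symm)
      _ ≤ ENNReal.ofReal ε * ∫⁻ w, ‖h.1 w‖ₑ ^ 2 ∂area +
          ENNReal.ofReal ε * ∫⁻ w, ‖g.1 w‖ₑ ^ 2 ∂area := by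
        rw [lintegral_add_left' hm.restrict]
        exact add_le_add (hle h.1 h.2) (hle g.1 g.2)
      _ = _ := by
        rw [← norm_toBergman_sq, ← norm_toBergman_sq, ← mul_add,
          ← ENNReal.ofReal_add (by positivity) (by positivity), ENNReal.ofReal_mul hε]
  rw [← ofReal_norm] at key
  exact (ENNReal.ofReal_le_ofReal_iff (by positivity)).1 key

/-- Truncations along R_k ↑ 1 form a Cauchy sequence of compact operators. Their limit is identified
on the kernel span by pairing with K_z: the truncated integrals converge to the full Toeplitz
integral because the balls exhaust the disk. -/
theorem isCompactToeplitz_of_tendsto_berezin {n : ℕ} (hn : 1 ≤ n) {f : ℂ → ℝ}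
    (hf : Integrable f area) (hf0 : ∀ᵐ w ∂area, 0 ≤ f w)
    (hB : Tendsto (fun z => berezin n (fun w => (f w : ℂ)) z) toBoundary (𝓝 0)) :
    IsCompactToeplitz n (fun w => (f w : ℂ)) := by
  have := completeSpace_bergmanSpace hn
  obtain ⟨R, hRmono, hR1, hRlim⟩ := exists_seq_strictMono_tendsto (1 : ℝ)
  choose A hAc hAe using fun k => exists_truncatedToeplitz hn hf (hR1 k)
  have hA : CauchySeq A := by
    refine (Metric.cauchySeq_iff' (u := A)).2 fun ε hε => ?_
    obtain ⟨R₀, hR₀, hle⟩ := exists_setLIntegral_le_of_tendsto_berezin hn hf hf0 hB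
      (ε := ε / 4) (by positivity)
    obtain ⟨N, hN⟩ := (hRlim.eventually_const_le hR₀).exists
    refine ⟨N, fun k hk => ?_⟩
    refine lt_of_eq_of_lt (dist_eq_norm (A k) (A N)) ?_
    exact (norm_sub_le_of_inner_eq_setIntegral hf hf0 (by positivity) (hRmono.monotone hk)
      (hR1 k) (hle (R N) hN) (hAe N) (hAe k)).trans_lt (by linarith)
  obtain ⟨T, hT⟩ := cauchySeq_tendsto_of_complete hA
  refine ⟨T, fun h hh => ?_, isCompactOperator_of_tendsto hT
    (Eventually.of_forall hAc)⟩
  obtain ⟨g, hg⟩ := toBergman_surjective n (T (toBergman n ⟨h, kernelSpan_le n hh⟩))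
  have heq : Set.EqOn (toeplitz n (fun w => (f w : ℂ)) h) g.1 unitDisk := by
    intro z hz
    have hlim : Tendsto (fun k => inner ℂ (kernelVector n z)
        (A k (toBergman n ⟨h, kernelSpan_le n hh⟩))) atTop (𝓝 (g.1 z)) := by
      rw [← inner_kernelVector hn hz g, hg]
      exact tendsto_const_nhds.inner
        (((ContinuousLinearMap.apply ℂ (bergmanSpace n) _).continuous.tendsto T).comp hT)
    have hlim' : Tendsto (fun k => ∫ w in Metric.ball 0 (R k),
        (f w : ℂ) * h w * conj (kernel n z w) ∂area) atTop
        (𝓝 (toeplitz n (fun w => (f w : ℂ)) h z)) := by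
      have hU : ⋃ k, Metric.ball (0 : ℂ) (R k) = unitDisk := by
        refine Set.Subset.antisymm
          (Set.iUnion_subset fun k => Metric.ball_subset_ball (hR1 k).le) fun w hw => ?_
        obtain ⟨k, hk⟩ := (hRlim.eventually_const_lt (mem_unitDisk.1 hw)).exists
        exact Set.mem_iUnion.2 ⟨k, by simpa using hk⟩
      have := tendsto_setIntegral_of_monotone (μ := area) (s := fun k => Metric.ball (0 : ℂ) (R k))
        (fun k => measurableSet_ball)
        (fun i j hij => Metric.ball_subset_ball (hRmono.monotone hij))
        (integrable_toeplitz hn hf hh hz).integrableOn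
      have hae : (unitDisk : Set ℂ) =ᵐ[area] Set.univ := ae_eq_univ.2 ae_mem_unitDisk
      rwa [hU, setIntegral_congr_set hae, setIntegral_univ] at this
    refine tendsto_nhds_unique (hlim'.congr fun k => ?_) hlim
    rw [kernelVector, hAe]
  refine ⟨mem_bergmanFun_congr g.2 heq, ?_⟩
  rw [← hg]
  exact (toBergman_congr heq).symm

/-! ### Necessity: compactness forces boundary decay of the Berezin transform. -/

/-- The multiple of `K_z` of constant norm. -/
noncomputable def scaledKernelVector (n : ℕ) (z : ℂ) : bergmanSpace n :=
  ((1 - ‖z‖ ^ 2 : ℝ) : ℂ) • kernelVector n z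

theorem inner_scaledKernelVector_left (n : ℕ) (z : ℂ) (x : bergmanSpace n) :
    inner ℂ (scaledKernelVector n z) x =
      ((1 - ‖z‖ ^ 2 : ℝ) : ℂ) * inner ℂ (kernelVector n z) x := by
  have := inner_smul_left (kernelVector n z) x ((1 - ‖z‖ ^ 2 : ℝ) : ℂ)
  rwa [Complex.conj_ofReal] at this

theorem inner_map_scaledKernelVector {n : ℕ} (T : bergmanSpace n →L[ℂ] bergmanSpace n) (z : ℂ)
    (x : bergmanSpace n) : inner ℂ x (T (scaledKernelVector n z)) =
      ((1 - ‖z‖ ^ 2 : ℝ) : ℂ) * inner ℂ x (T (kernelVector n z)) := by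
  rw [scaledKernelVector, map_smul]
  exact inner_smul_right x (T (kernelVector n z)) ((1 - ‖z‖ ^ 2 : ℝ) : ℂ)

theorem norm_scaledKernelVector_sq {n : ℕ} (hn : 1 ≤ n) {z : ℂ} (hz : z ∈ unitDisk) :
    ‖scaledKernelVector n z‖ ^ 2 = (momentPolynomial n).eval 0 := by
  have := one_sub_sq_pos hz
  rw [scaledKernelVector, norm_smul, mul_pow, norm_kernelVector_sq hn hz, Complex.norm_real,
    Real.norm_eq_abs, sq_abs]
  field_simp

theorem ExtendsToeplitz.inner_kernelVector {n : ℕ} (hn : 1 ≤ n) {f : ℂ → ℂ}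
    {T : bergmanSpace n →L[ℂ] bergmanSpace n} (hT : ExtendsToeplitz n f T) {ζ z : ℂ}
    (hζ : ζ ∈ unitDisk) (hz : z ∈ unitDisk) :
    inner ℂ (kernelVector n ζ) (T (kernelVector n z)) = toeplitz n f (kernel n z) ζ := by
  obtain ⟨hg, he⟩ := hT _ (kernel_mem_kernelSpan hz)
  have : T (kernelVector n z) = toBergman n ⟨_, hg⟩ := he
  rw [this, PolyBergman.inner_kernelVector hn hζ]

/-- Symmetry from f being real. It exchanges the moving point z, going to the boundary, with a fixed
ζ, so that the decay of the single function T_f K_ζ can be used. -/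
theorem toeplitz_kernel_conj (n : ℕ) (f : ℂ → ℝ) (z ζ : ℂ) :
    toeplitz n (fun w => (f w : ℂ)) (kernel n z) ζ =
      conj (toeplitz n (fun w => (f w : ℂ)) (kernel n ζ) z) := by
  rw [toeplitz, toeplitz, ← integral_conj]
  congr 1
  funext w
  simp only [map_mul, Complex.conj_conj, Complex.conj_ofReal]
  ring

theorem ExtendsToeplitz.berezin_eq {n : ℕ} (hn : 1 ≤ n) {f : ℂ → ℂ}
    {T : bergmanSpace n →L[ℂ] bergmanSpace n} (hT : ExtendsToeplitz n f T) {z : ℂ}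
    (hz : z ∈ unitDisk) :
    berezin n f z = (((momentPolynomial n).eval 0 : ℝ) : ℂ)⁻¹ *
      inner ℂ (scaledKernelVector n z) (T (scaledKernelVector n z)) := by
  have hq : (((momentPolynomial n).eval 0 : ℝ) : ℂ) ≠ 0 := by
    exact_mod_cast (momentPolynomial_eval_zero_pos hn).ne'
  have h0 := one_sub_sq_ne_zero hz
  rw [inner_scaledKernelVector_left, inner_map_scaledKernelVector,
    hT.inner_kernelVector hn hz hz, toeplitz, berezin,
    ← integral_const_mul, ← integral_const_mul, ← integral_const_mul]
  congr 1
  funext w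
  rw [normalizedKernel, norm_div, div_pow, Complex.norm_real, Real.norm_eq_abs, sq_abs,
    Real.sq_sqrt (integral_nonneg fun v => sq_nonneg _), integral_norm_kernel_sq hn hz,
    mul_assoc (f w), Complex.mul_conj']
  push_cast
  field_simp

/-- The images stay in a compact set, so it is enough that every cluster point y is 0. Pairing with
K_ζ, y(ζ) is a cluster value of the conjugate of (1-|z|²)(T_f K_ζ)(z), which tends to 0. No weak
convergence of the kernel vectors themselves is needed. -/
theorem tendsto_apply_scaledKernelVector {n : ℕ} (hn : 1 ≤ n) {f : ℂ → ℝ}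
    {T : bergmanSpace n →L[ℂ] bergmanSpace n}
    (hT : ExtendsToeplitz n (fun w => (f w : ℂ)) T) (hc : IsCompactOperator T) :
    Tendsto (fun z => T (scaledKernelVector n z)) toBoundary (𝓝 0) := by
  obtain ⟨K, hK, hKsub⟩ := IsCompactOperator.image_closedBall_subset_compact
    (f := (T : bergmanSpace n →ₗ[ℂ] bergmanSpace n)) hc
    (Real.sqrt ((momentPolynomial n).eval 0))
  refine hK.tendsto_nhds_of_unique_mapClusterPt ?_ fun y _ hy => ?_
  · filter_upwards [eventually_mem_unitDisk] with z hz
    refine hKsub ⟨_, ?_, rfl⟩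
    rw [mem_closedBall_zero_iff]
    exact Real.le_sqrt_of_sq_le (norm_scaledKernelVector_sq hn hz).le
  · obtain ⟨g, rfl⟩ := toBergman_surjective n y
    have hzero : Set.EqOn g.1 (0 : bergmanFun n).1 unitDisk := by
      intro ζ hζ
      obtain ⟨hg', -⟩ := hT _ (kernel_mem_kernelSpan hζ)
      have hlim : Tendsto (fun z => inner ℂ (kernelVector n ζ) (T (scaledKernelVector n z)))
          toBoundary (𝓝 0) := by
        have h1 := (Complex.continuous_conj.tendsto 0).comp (tendsto_mul_apply_toBoundary hn hg')
        rw [map_zero] at h1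
        refine h1.congr' ?_
        filter_upwards [eventually_mem_unitDisk] with z hz
        rw [inner_map_scaledKernelVector,
          hT.inner_kernelVector hn hζ hz, toeplitz_kernel_conj, Function.comp_apply, map_mul, Complex.conj_ofReal]
      have hcl : MapClusterPt (inner ℂ (kernelVector n ζ) (toBergman n g)) toBoundary
          fun z => inner ℂ (kernelVector n ζ) (T (scaledKernelVector n z)) :=
        MapClusterPt.continuousAt_comp (f := fun x => inner ℂ (kernelVector n ζ) x)
          (continuous_const.inner continuous_id).continuousAt hy
      rw [inner_kernelVector hn hζ] at hcl
      have : (𝓝 (g.1 ζ) ⊓ 𝓝 0).NeBot := hcl.neBot.mono (inf_le_inf_left _ hlim)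
      exact eq_of_nhds_neBot this
    rw [toBergman_congr hzero, map_zero]

theorem tendsto_berezin_of_isCompactToeplitz {n : ℕ} (hn : 1 ≤ n) {f : ℂ → ℝ}
    (h : IsCompactToeplitz n (fun w => (f w : ℂ))) :
    Tendsto (fun z => berezin n (fun w => (f w : ℂ)) z) toBoundary (𝓝 0) := by
  obtain ⟨T, hT, hc⟩ := h
  have h1 := (tendsto_apply_scaledKernelVector hn hT hc).norm.const_mul
    (‖(((momentPolynomial n).eval 0 : ℝ) : ℂ)⁻¹‖ * Real.sqrt ((momentPolynomial n).eval 0))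
  rw [norm_zero, mul_zero] at h1
  refine squeeze_zero_norm' ?_ h1
  filter_upwards [eventually_mem_unitDisk] with z hz
  rw [hT.berezin_eq hn hz, norm_mul, mul_assoc]
  refine mul_le_mul_of_nonneg_left ((norm_inner_le_norm _ _).trans_eq ?_) (norm_nonneg _)
  rw [← norm_scaledKernelVector_sq hn hz, Real.sqrt_sq (norm_nonneg _)]

end PolyBergman

-- The first conjunct certifies that `kernel` really is the reproducing kernel on the disk, not the
-- default value 0 in its definition.
open PolyBergman in
theorem theoremT (n : ℕ) (hn : 1 ≤ n) (f : ℂ → ℝ) (hf : MeasureTheory.Integrable f area)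
    (hf0 : ∀ᵐ w ∂area, 0 ≤ f w) :
    (∀ z ∈ unitDisk, IsReproducingAt n z (kernel n z)) ∧
    (IsCompactToeplitz n (fun w => (f w : ℂ)) ↔
      Filter.Tendsto (fun z => berezin n (fun w => (f w : ℂ)) z)
        (Filter.comap (fun z : ℂ => ‖z‖) (nhdsWithin 1 (Set.Iio 1))) (nhds 0)) :=
  ⟨fun _ hz => isReproducingAt_kernel hn hz, tendsto_berezin_of_isCompactToeplitz hn,
    isCompactToeplitz_of_tendsto_berezin hn hf hf0⟩
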